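/- Let $K>2$ be an integer and let $H=(h_{i,j})\in\mathbb{R}^{K\times K}$ be the gain matrix of a real, scalar $K$-user Gaussian interference channel: at time $t$, receiver $j\in\{1,\dots,K\}$ observes $y_{j,t}=z_{j,t}+\sum_{i=1}^K x_{i,t}h_{i,j}$, where $x_{i,t}\in\mathbb{R}$ is the signal of transmitter $i$ and the $z_{j,t}$ are Gaussian noises of mean $0$ and variance $1$, independent across $j$ and $t$. For $P>0$ let $\mathcal{C}(H,P)$ be the set of rate tuples $\mathbf{R}=(R_1,\dots,R_K)$ with all $R_i\ge 0$ for which there exist, for every block length $n$, encoding functions $f_i:\mathcal{W}_i\to\{x\in\mathbb{R}^n:\sum_{t=1}^n x_t^2\le nP\}$, where $\mathcal{W}_i=\{1,\dots,2^{\lceil nR_i\rceil}\}$, and (measurable) decoding functions $g_i:\mathbb{R}^n\to\mathcal{W}_i$, such that, when the messages $W_i$ are uniformly distributed on $\mathcal{W}_i$, independent of each other and of the noise, and transmitter $i$ sends $f_i(W_i)$, the error probabilities satisfy $$\lim_{n\to\infty}\max_{1\le i\le K}\Pr\big(W_i\ne g_i(y_{i,1},\dots,y_{i,n})\big)=0 .$$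 The degrees-of-freedom of $H$ is $$DoF(H)=\limsup_{P\to\infty}\frac{\sup_{\mathbf{R}\in\mathcal{C}(H,P)}\sum_{i=1}^K R_i}{\tfrac12\log_2 P}.$$ Theorem. If all entries of $H$ are nonzero (that is, $H$ is fully connected) and rational, then $DoF(H)<K/2$. -/

import Mathlib

open MeasureTheory ProbabilityTheory Filter Topology
open scoped NNReal ENNReal

namespace GIFC

/-- The message set of user `i` at block length `n` and rate `R i`: it has `2 ^ ⌈n R i⌉` elements
(rates are nonnegative wherever this is used). -/
abbrev Message {K : ℕ} (n : ℕ) (R : Fin K → ℝ) (i : Fin K) : Type :=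
  Fin (2 ^ ⌈(n : ℝ) * R i⌉₊)

/-- A coding scheme of block length `n` for `K` users with rates `R` and powers `P`: every codeword
of user `i` lies in the Euclidean ball of radius `√(n P i)`, and receiver `i` decodes
the message of transmitter `i` from the `n` real values that it observes. -/
structure CodingScheme {K : ℕ} (n : ℕ) (R P : Fin K → ℝ) where
  /-- the encoding functions -/
  encode : (i : Fin K) → Message n R i → Fin n → ℝ
  /-- the average power constraint on each codeword -/
  power_le : ∀ (i : Fin K) (w : Message n R i), ∑ t, encode i w t ^ 2 ≤ n * P i
  /-- the decoding functions -/
  decode : (i : Fin K) → (Fin n → ℝ) → Message n R i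
  measurable_decode : ∀ i, Measurable (decode i)

/-- The block observed by receiver `j`: at time `t` it is `z j t + ∑ i, x i t * H i j`, where
`H i j` is the gain from transmitter `i` to receiver `j`. -/
def received {K n : ℕ} (H : Matrix (Fin K) (Fin K) ℝ) (x z : Fin K → Fin n → ℝ) (j : Fin K) :
    Fin n → ℝ :=
  fun t => z j t + ∑ i, x i t * H i j

/-- The joint law of the messages: independent, each uniform on its message set. -/
noncomputable def messageLaw {K : ℕ} (n : ℕ) (R : Fin K → ℝ) :
    Measure ((i : Fin K) → Message n R i) :=
  Measure.pi fun _ => uniformOn Set.univ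

/-- The joint law of the noise: centred Gaussian of variance `σ j` at receiver `j`,
independent across receivers and times. -/
noncomputable def noiseLaw {K : ℕ} (n : ℕ) (σ : Fin K → ℝ≥0) : Measure (Fin K → Fin n → ℝ) :=
  Measure.pi fun j => Measure.pi fun _ => gaussianReal 0 (σ j)

/-- The probability that receiver `j` decodes its message incorrectly, with respect to the
random messages and the (independent) noise. -/
noncomputable def CodingScheme.errorProb {K n : ℕ} {R P : Fin K → ℝ} (S : CodingScheme n R P)
    (H : Matrix (Fin K) (Fin K) ℝ) (σ : Fin K → ℝ≥0) (j : Fin K) : ℝ≥0∞ :=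
  ((messageLaw n R).prod (noiseLaw n σ))
    {p | S.decode j (received H (fun i => S.encode i (p.1 i)) p.2 j) ≠ p.1 j}

/-- The capacity region of the `K`-user Gaussian interference channel with gain matrix `H`,
noise variances `σ` and power constraints `P`. -/
def capacityRegion {K : ℕ} (H : Matrix (Fin K) (Fin K) ℝ) (σ : Fin K → ℝ≥0) (P : Fin K → ℝ) :
    Set (Fin K → ℝ) :=
  {R | (∀ i, 0 ≤ R i) ∧ ∃ S : (n : ℕ) → CodingScheme n R P,
    Tendsto (fun n => ⨆ j, (S n).errorProb H σ j) atTop (𝓝 0)}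

/-- The largest sum rate over the capacity region with unit noise variances and all powers
equal to `P`, as an extended real (so that no boundedness is presupposed). -/
noncomputable def sumCapacity {K : ℕ} (H : Matrix (Fin K) (Fin K) ℝ) (P : ℝ) : EReal :=
  ⨆ R ∈ capacityRegion H (fun _ => 1) (fun _ => P), ((∑ i, R i : ℝ) : EReal)

/-- The degrees-of-freedom of `H`. -/
noncomputable def DoF {K : ℕ} (H : Matrix (Fin K) (Fin K) ℝ) : EReal :=
  limsup (fun P : ℝ => sumCapacity H P / ((1 / 2 * Real.logb 2 P : ℝ) : EReal)) atTop

/-- All direct and cross gains are nonzero. -/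
def FullyConnected {K : ℕ} (H : Matrix (Fin K) (Fin K) ℝ) : Prop :=
  ∀ i j, H i j ≠ 0

end GIFC

/-!
Since every message is uniform, all the information theory takes place on finite uniform probability
spaces, with Shannon entropies of functions on them (`entropy`); no differential entropy occurs.

*Reduction to integers.* Let `D` be a common denominator of the gains, `a i j = D * H i j`, and round
the codewords down to integer vectors `X i`. Receiver `j` sees the integer output
`V j = ∑ i, a i j • X i` up to Gaussian noise and a bounded rounding error. All noise laws that
belong to one value of `V j` are dominated by a single measure of mass `C ^ n`, so at most
`2 * C ^ n` messages can be decoded from it with probability at least one half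
(`card_image_le_of_decoded`). A form of Fano's inequality (`entropy_prod_sub_le`) then bounds the
entropy of message `j` given `V j` by `O(n)` (`CodingScheme.entropy_message_sub_le`), while counting
integer points gives `V j` an entropy of at most `L + O(n)`, where `L = n / 2 * log P`
(`CodingScheme.entropy_output_le`). Hence the `j`-th rate plus the entropy of the interference at
receiver `j` is at most `L + O(n)`. In particular two users together get at most one degree of
freedom, and if the sum rate were nearly `K / 2`, then every pair of users would nearly attain this
bound (`pair_deficit_le`), and every user would get nearly one half.

*Alignment of rational combinations.* Take three users `i`, `k`, `l`. The interference at receiver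
`l` then has entropy close to `L / 2`, so `a i l • X i + a k l • X k` has hardly more entropy than
each of its independent summands. By sumset inequalities for entropy, all of them consequences of
submodularity (the Ruzsa triangle inequality, the inequality of Kaimanovich, Vershik and Madiman, and
a bound for dilates), every integer combination of `X i` and `X k` then has entropy close to `L / 2`
(`entropy_combination_le`). But receiver `i` must tell `X i` from the interference of user `k`, which
requires `a i i • X i + a k i • X k` to have entropy close to `L`. All losses are linear, with
constants that depend on the gains only, so the sum rate is bounded away from `K / 2`
(`exists_sum_rate_lt`).
-/

namespace GIFC

/-! ### Entropy on finite uniform probability spaces -/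

section Entropy

variable {Ω Ω' α β γ : Type*} [Fintype Ω] [Fintype Ω']

open Classical in
/-- The number of points at which `f` takes the value `a`. -/
noncomputable def fiberCard (f : Ω → α) (a : α) : ℕ := (Finset.univ.filter fun ω => f ω = a).card

/-- The Shannon entropy, in nats, of `f ω` for `ω` uniformly distributed on the finite type `Ω`. -/
noncomputable def entropy (f : Ω → α) : ℝ :=
  (∑ ω, Real.log (Fintype.card Ω / fiberCard f (f ω))) / Fintype.card Ω

lemma fiberCard_pos (f : Ω → α) (ω : Ω) : 0 < (fiberCard f (f ω) : ℝ) := by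
  classical
  rw [Nat.cast_pos, fiberCard, Finset.card_pos]
  exact ⟨ω, by simp⟩

lemma fiberCard_le (f : Ω → α) (a : α) : (fiberCard f a : ℝ) ≤ Fintype.card Ω := by
  classical
  exact_mod_cast Finset.card_le_univ _

lemma card_mul_entropy [Nonempty Ω] (f : Ω → α) :
    Fintype.card Ω * entropy f = ∑ ω, Real.log (Fintype.card Ω / fiberCard f (f ω)) := by
  rw [entropy]
  field_simp

lemma cast_card_pos [Nonempty Ω] : 0 < (Fintype.card Ω : ℝ) := by
  exact_mod_cast Fintype.card_pos

lemma entropy_nonneg (f : Ω → α) : 0 ≤ entropy f := by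
  refine div_nonneg (Finset.sum_nonneg fun ω _ => Real.log_nonneg ?_) (Nat.cast_nonneg _)
  rw [one_le_div (fiberCard_pos f ω)]
  exact fiberCard_le _ _

lemma sum_log_le_zero (x : Ω → ℝ) (hx : ∀ ω, 0 < x ω) (h : ∑ ω, x ω ≤ Fintype.card Ω) :
    ∑ ω, Real.log (x ω) ≤ 0 := by
  calc ∑ ω, Real.log (x ω) ≤ ∑ ω, (x ω - 1) :=
        Finset.sum_le_sum fun ω _ => Real.log_le_sub_one_of_pos (hx ω)
    _ ≤ 0 := by simp [Finset.sum_sub_distrib]; linarith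

/-- A function determined by another one has smaller entropy. -/
lemma entropy_mono (f : Ω → α) (g : Ω → β) (h : ∀ ω ω', g ω = g ω' → f ω = f ω') :
    entropy f ≤ entropy g := by
  classical
  refine div_le_div_of_nonneg_right (Finset.sum_le_sum fun ω _ => ?_) (Nat.cast_nonneg _)
  have : Nonempty Ω := ⟨ω⟩
  refine Real.log_le_log (div_pos cast_card_pos (fiberCard_pos f ω))
    (div_le_div_of_nonneg_left cast_card_pos.le (fiberCard_pos g ω) ?_)
  rw [Nat.cast_le]
  refine Finset.card_le_card fun ω' hω' => ?_
  simp only [Finset.mem_filter, Finset.mem_univ, true_and] at hω' ⊢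
  exact h _ _ hω'

lemma entropy_congr (f : Ω → α) (g : Ω → β) (h : ∀ ω ω', g ω = g ω' ↔ f ω = f ω') :
    entropy f = entropy g :=
  le_antisymm (entropy_mono f g fun _ _ => (h _ _).1) (entropy_mono g f fun _ _ => (h _ _).2)

lemma sum_div_fiberCard (f : Ω → α) (k : α → ℝ) [DecidableEq α] :
    ∑ ω, k (f ω) / fiberCard f (f ω) = ∑ a ∈ Finset.univ.image f, k a := by
  rw [← Finset.sum_fiberwise_of_maps_to (t := Finset.univ.image f) (g := f)
    (fun ω _ => Finset.mem_image_of_mem f (Finset.mem_univ ω))]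
  refine Finset.sum_congr rfl fun a ha => ?_
  obtain ⟨ω, -, rfl⟩ := Finset.mem_image.1 ha
  rw [Finset.sum_congr rfl (g := fun _ => k (f ω) / fiberCard f (f ω))
    (fun ω' hω' => by rw [(Finset.mem_filter.1 hω').2])]
  rw [Finset.sum_const, nsmul_eq_mul]
  have h1 := fiberCard_pos f ω
  have : ((Finset.univ.filter fun ω' => f ω' = f ω).card : ℝ) = fiberCard f (f ω) := by
    rw [fiberCard]; congr!
  rw [this]
  field_simp

/-- The counting bound behind submodularity: for fixed `ω₁`, `ω₂`, the points `ω` that agree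
with `ω₁` under `f` and with `ω₂` under `g` form at most one fibre of `(f, g)`, and none unless
`z ω₁ = z ω₂`. -/
lemma sum_fiberCard_ratio_le [Nonempty Ω] (f : Ω → α) (g : Ω → β) (z : Ω → γ)
    (hf : ∀ ω ω', f ω = f ω' → z ω = z ω') (hg : ∀ ω ω', g ω = g ω' → z ω = z ω') :
    ∑ ω, (fiberCard f (f ω) * fiberCard g (g ω) : ℝ) /
      (fiberCard (fun ω => (f ω, g ω)) (f ω, g ω) * fiberCard z (z ω)) ≤ Fintype.card Ω := by
  classical
  set N : Ω → ℝ := fun ω => fiberCard (fun ω => (f ω, g ω)) (f ω, g ω) with hN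
  have hNpos : ∀ ω, 0 < N ω := fun ω => fiberCard_pos (fun ω => (f ω, g ω)) ω
  have h1 : ∀ ω, (fiberCard f (f ω) * fiberCard g (g ω) : ℝ) / (N ω * fiberCard z (z ω))
      = ∑ ω₁, ∑ ω₂, if f ω₁ = f ω ∧ g ω₂ = g ω then 1 / (N ω * fiberCard z (z ω)) else 0 := by
    intro ω
    have : (fiberCard f (f ω) * fiberCard g (g ω) : ℝ) =
        ∑ ω₁, ∑ ω₂, if f ω₁ = f ω ∧ g ω₂ = g ω then 1 else 0 := by
      rw [fiberCard, fiberCard, Finset.card_filter, Finset.card_filter]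
      push_cast
      rw [Finset.sum_mul_sum]
      refine Finset.sum_congr rfl fun ω₁ _ => Finset.sum_congr rfl fun ω₂ _ => ?_
      by_cases h1 : f ω₁ = f ω <;> by_cases h2 : g ω₂ = g ω <;> simp [h1, h2]
    rw [this, Finset.sum_div]
    refine Finset.sum_congr rfl fun ω₁ _ => ?_
    rw [Finset.sum_div]
    refine Finset.sum_congr rfl fun ω₂ _ => ?_
    split_ifs <;> simp
  have h2 : ∀ ω₁ ω₂, (∑ ω, if f ω₁ = f ω ∧ g ω₂ = g ω then 1 / (N ω * fiberCard z (z ω)) else 0)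
      ≤ if z ω₂ = z ω₁ then 1 / (fiberCard z (z ω₁) : ℝ) else 0 := by
    intro ω₁ ω₂
    by_cases hex : ∃ ω₀, f ω₁ = f ω₀ ∧ g ω₂ = g ω₀
    · obtain ⟨ω₀, h₁, h₂⟩ := hex
      have hz : z ω₁ = z ω₀ := hf _ _ h₁
      rw [if_pos ((hg _ _ h₂).trans hz.symm), hz]
      rw [h₁, h₂, ← Finset.sum_filter]
      rw [Finset.sum_congr rfl (g := fun _ => 1 / (N ω₀ * fiberCard z (z ω₀)))]
      · rw [Finset.sum_const, nsmul_eq_mul]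
        have : ((Finset.univ.filter fun ω => f ω₀ = f ω ∧ g ω₀ = g ω).card : ℝ) = N ω₀ := by
          simp only [hN, fiberCard]
          congr 2
          ext ω
          simp only [Prod.mk.injEq, eq_comm]
        rw [this]
        have := hNpos ω₀
        have := fiberCard_pos z ω₀
        field_simp
        exact le_rfl
      · intro ω hω
        obtain ⟨h3, h4⟩ := (Finset.mem_filter.1 hω).2
        simp only [hN]
        rw [← h3, ← h4, hf _ _ h3]
    · rw [Finset.sum_eq_zero]
      · split_ifs
        · positivity
        · exact le_rfl
      · intro ω _
        rw [if_neg fun h => hex ⟨ω, h⟩]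
  calc _ = ∑ ω, ∑ ω₁, ∑ ω₂,
        if f ω₁ = f ω ∧ g ω₂ = g ω then 1 / (N ω * fiberCard z (z ω)) else 0 :=
        Finset.sum_congr rfl fun ω _ => h1 ω
    _ = ∑ ω₁, ∑ ω₂, ∑ ω,
        if f ω₁ = f ω ∧ g ω₂ = g ω then 1 / (N ω * fiberCard z (z ω)) else 0 := by
        rw [Finset.sum_comm]
        exact Finset.sum_congr rfl fun ω₁ _ => Finset.sum_comm
    _ ≤ ∑ ω₁, ∑ ω₂, if z ω₂ = z ω₁ then 1 / (fiberCard z (z ω₁) : ℝ) else 0 :=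
        Finset.sum_le_sum fun ω₁ _ => Finset.sum_le_sum fun ω₂ _ => h2 ω₁ ω₂
    _ = ∑ ω₁ : Ω, (1 : ℝ) := by
        refine Finset.sum_congr rfl fun ω₁ _ => ?_
        rw [← Finset.sum_filter, Finset.sum_const, nsmul_eq_mul]
        have := fiberCard_pos z ω₁
        exact mul_one_div_cancel this.ne'
    _ = Fintype.card Ω := by simp

/-- Submodularity of entropy. -/
lemma entropy_submodular [Nonempty Ω] (f : Ω → α) (g : Ω → β) (z : Ω → γ)
    (hf : ∀ ω ω', f ω = f ω' → z ω = z ω') (hg : ∀ ω ω', g ω = g ω' → z ω = z ω') :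
    entropy (fun ω => (f ω, g ω)) + entropy z ≤ entropy f + entropy g := by
  refine le_of_mul_le_mul_left ?_ (cast_card_pos (Ω := Ω))
  rw [mul_add, mul_add]
  simp only [card_mul_entropy]
  rw [← Finset.sum_add_distrib, ← Finset.sum_add_distrib, ← sub_nonpos, ← Finset.sum_sub_distrib]
  refine le_trans (le_of_eq ?_) (sum_log_le_zero _ (fun ω => ?_)
    (sum_fiberCard_ratio_le f g z hf hg))
  · refine Finset.sum_congr rfl fun ω _ => ?_
    have h0 := (cast_card_pos (Ω := Ω)).ne'
    have h1 := (fiberCard_pos f ω).ne'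
    have h2 := (fiberCard_pos g ω).ne'
    have h3 := (fiberCard_pos z ω).ne'
    have h4 := (fiberCard_pos (fun ω => (f ω, g ω)) ω).ne'
    rw [Real.log_div h0 h4, Real.log_div h0 h3, Real.log_div h0 h1, Real.log_div h0 h2,
      Real.log_div (mul_ne_zero h1 h2) (mul_ne_zero h4 h3), Real.log_mul h1 h2, Real.log_mul h4 h3]
    ring
  · have h1 := fiberCard_pos f ω
    have h2 := fiberCard_pos g ω
    have h3 := fiberCard_pos z ω
    have h4 := fiberCard_pos (fun ω => (f ω, g ω)) ω
    positivity

lemma entropy_prod_le [Nonempty Ω] (f : Ω → α) (g : Ω → β) :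
    entropy (fun ω => (f ω, g ω)) ≤ entropy f + entropy g := by
  have h := entropy_submodular f g (fun _ => ()) (fun _ _ _ => rfl) (fun _ _ _ => rfl)
  have := entropy_nonneg (fun _ : Ω => ())
  linarith

/-- Independence: `m a b` takes its `f`-part from `a` and its `g`-part from `b`, and exchanging
parts loses no information. -/
lemma entropy_add_le_prod [Nonempty Ω] (f : Ω → α) (g : Ω → β) (m : Ω → Ω → Ω)
    (hf : ∀ a b, f (m a b) = f a) (hg : ∀ a b, g (m a b) = g b)
    (hm : Function.Injective fun p : Ω × Ω => (m p.1 p.2, m p.2 p.1)) :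
    entropy f + entropy g ≤ entropy (fun ω => (f ω, g ω)) := by
  classical
  refine le_of_mul_le_mul_left ?_ (cast_card_pos (Ω := Ω))
  rw [mul_add]
  simp only [card_mul_entropy]
  rw [← Finset.sum_add_distrib]
  refine Finset.sum_le_sum fun ω _ => ?_
  have h0 := cast_card_pos (Ω := Ω)
  have h1 := fiberCard_pos f ω
  have h2 := fiberCard_pos g ω
  have h4 := fiberCard_pos (fun ω => (f ω, g ω)) ω
  rw [← Real.log_mul (by positivity) (by positivity)]
  refine Real.log_le_log (by positivity) ?_
  rw [div_mul_div_comm, div_le_div_iff₀ (by positivity) h4, mul_assoc]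
  refine mul_le_mul_of_nonneg_left ?_ h0.le
  rw [mul_comm]
  have : fiberCard (fun ω => (f ω, g ω)) (f ω, g ω) * Fintype.card Ω ≤
      fiberCard f (f ω) * fiberCard g (g ω) := by
    rw [fiberCard, fiberCard, fiberCard, ← Finset.card_univ, ← Finset.card_product,
      ← Finset.card_product]
    refine Finset.card_le_card_of_injOn _ (fun p hp => ?_) hm.injOn
    simp only [Finset.coe_product, Set.mem_prod, Finset.coe_filter, Finset.mem_univ, true_and,
      Set.mem_ofPred_eq, Prod.mk.injEq, Finset.mem_coe] at hp ⊢
    rw [hf, hg]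
    exact hp.1
  exact_mod_cast this

/-- Entropy is invariant under a surjection whose fibres all have the same size. -/
lemma entropy_comp (π : Ω → Ω') (hπ : Function.Surjective π) (k : ℕ)
    (hk : ∀ ω, fiberCard π (π ω) = k) (f : Ω' → α) :
    entropy (fun ω => f (π ω)) = entropy f := by
  classical
  rcases isEmpty_or_nonempty Ω with hΩ | hΩ
  · have : IsEmpty Ω' := ⟨fun b => by obtain ⟨a, -⟩ := hπ b; exact hΩ.elim a⟩
    simp [entropy]
  have hk' : ∀ b, fiberCard π b = k := fun b => by obtain ⟨a, rfl⟩ := hπ b; exact hk a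
  have hk0 : (0 : ℝ) < k := by
    rw [← hk (Classical.arbitrary Ω)]
    exact fiberCard_pos π _
  have hsum : ∀ F : Ω' → ℝ, ∑ ω, F (π ω) = k * ∑ b, F b := by
    intro F
    rw [← Finset.sum_fiberwise (s := Finset.univ) (g := π), Finset.mul_sum]
    refine Finset.sum_congr rfl fun b _ => ?_
    rw [Finset.sum_congr rfl (g := fun _ => F b)
      (fun ω hω => by rw [(Finset.mem_filter.1 hω).2]), Finset.sum_const, nsmul_eq_mul, ← hk' b,
      fiberCard]
  have hcard : (Fintype.card Ω : ℝ) = k * Fintype.card Ω' := by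
    simpa using hsum fun _ => 1
  have hfib : ∀ a, (fiberCard (fun ω => f (π ω)) a : ℝ) = k * fiberCard f a := by
    intro a
    rw [fiberCard, fiberCard, Finset.card_filter, Finset.card_filter]
    push_cast
    exact hsum fun b => if f b = a then 1 else 0
  rw [entropy, entropy, hsum fun b => Real.log (Fintype.card Ω / fiberCard (fun ω => f (π ω)) (f b)),
    hcard, mul_div_mul_left _ _ hk0.ne']
  congr 1
  refine Finset.sum_congr rfl fun b _ => ?_
  rw [hfib, mul_div_mul_left _ _ hk0.ne']

lemma entropy_comp_equiv (e : Ω ≃ Ω') (f : Ω' → α) : entropy (fun ω => f (e ω)) = entropy f := by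
  classical
  refine entropy_comp e e.surjective 1 (fun ω => ?_) f
  rw [fiberCard, Finset.card_eq_one]
  exact ⟨ω, by ext; simp⟩

lemma entropy_comp_fst [Nonempty Ω'] (f : Ω → α) : entropy (fun p : Ω × Ω' => f p.1) = entropy f := by
  classical
  refine entropy_comp Prod.fst Prod.fst_surjective (Fintype.card Ω') (fun p => ?_) f
  rw [fiberCard, show (Finset.univ.filter fun q : Ω × Ω' => q.1 = p.1) = {p.1} ×ˢ Finset.univ by
    ext; simp [Finset.mem_product, -Finset.singleton_product]]
  simp

lemma entropy_comp_snd [Nonempty Ω'] (f : Ω → α) : entropy (fun p : Ω' × Ω => f p.2) = entropy f := by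
  rw [← entropy_comp_fst (Ω' := Ω') f]
  exact entropy_comp_equiv (Equiv.prodComm Ω' Ω) (fun p => f p.1)

lemma entropy_le_log_card [Nonempty Ω] (f : Ω → α) (S : Finset α) (hS : ∀ ω, f ω ∈ S) :
    entropy f ≤ Real.log S.card := by
  classical
  have hSpos : (0 : ℝ) < S.card := by
    exact_mod_cast Finset.card_pos.2 ⟨_, hS (Classical.arbitrary Ω)⟩
  have h0 := cast_card_pos (Ω := Ω)
  refine le_of_mul_le_mul_left ?_ h0
  rw [card_mul_entropy, ← sub_nonpos]
  have hle : (∑ ω, (Fintype.card Ω / S.card : ℝ) / fiberCard f (f ω)) ≤ Fintype.card Ω := by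
    rw [sum_div_fiberCard f (fun _ => (Fintype.card Ω / S.card : ℝ)), Finset.sum_const, nsmul_eq_mul,
      mul_div_assoc', div_le_iff₀ hSpos, mul_comm]
    refine mul_le_mul_of_nonneg_left ?_ h0.le
    exact_mod_cast Finset.card_le_card fun a ha => by
      obtain ⟨ω, -, rfl⟩ := Finset.mem_image.1 ha
      exact hS ω
  refine le_trans (le_of_eq ?_) (sum_log_le_zero _ (fun ω => ?_) hle)
  · have : (Fintype.card Ω : ℝ) * Real.log S.card = ∑ _ω : Ω, Real.log S.card := by simp
    rw [this, ← Finset.sum_sub_distrib]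
    refine Finset.sum_congr rfl fun ω _ => ?_
    have h1 := (fiberCard_pos f ω).ne'
    rw [Real.log_div h0.ne' h1, Real.log_div (div_ne_zero h0.ne' hSpos.ne') h1,
      Real.log_div h0.ne' hSpos.ne']
    ring
  · have h1 := fiberCard_pos f ω
    positivity

lemma entropy_id : entropy (fun ω : Ω => ω) = Real.log (Fintype.card Ω) := by
  classical
  rcases isEmpty_or_nonempty Ω with hΩ | hΩ
  · simp [entropy]
  refine mul_left_cancel₀ (cast_card_pos (Ω := Ω)).ne' ?_
  rw [card_mul_entropy]
  have : ∀ ω : Ω, fiberCard (fun ω : Ω => ω) ω = 1 := fun ω => by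
    rw [fiberCard, Finset.card_eq_one]
    exact ⟨ω, by ext; simp⟩
  simp [this]

/-- A form of Fano's inequality: if, outside a set of density at most `b`, the value of `V` leaves
at most `L` possibilities for `W`, then `W` has small entropy given `V`. -/
lemma entropy_prod_sub_le [Nonempty Ω] [Fintype β] [DecidableEq α] [DecidableEq β] (V : Ω → α) (W : Ω → β) (G : Finset Ω)
    (L b : ℝ) (hL : 1 ≤ L) (hb : (Fintype.card Ω - G.card : ℝ) ≤ b * Fintype.card Ω)
    (hG : ∀ v, (((G.filter fun ω => V ω = v).image W).card : ℝ) ≤ L) :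
    entropy (fun ω => (W ω, V ω)) - entropy V ≤
      Real.log (2 * L) + b * Real.log (2 * Fintype.card β) := by
  have : DecidableEq Ω := Classical.decEq Ω
  have hb : ((Gᶜ).card : ℝ) ≤ b * Fintype.card Ω := by
    have h : (G.card : ℝ) + (Gᶜ).card = Fintype.card Ω := by
      exact_mod_cast Finset.card_add_card_compl G
    linarith
  have hβ : Nonempty β := ⟨W (Classical.arbitrary Ω)⟩
  have h0 := cast_card_pos (Ω := Ω)
  have hM : (1 : ℝ) ≤ Fintype.card β := by exact_mod_cast Fintype.card_pos (α := β)
  have hM0 : (0 : ℝ) < Fintype.card β := by linarith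
  have hL0 : 0 < L := by linarith
  set P : Ω → α × β := fun ω => (V ω, W ω) with hP
  have hPW : entropy (fun ω => (W ω, V ω)) = entropy P :=
    entropy_congr _ _ fun ω ω' => by simp [hP, and_comm]
  rw [hPW]
  set k : Ω → ℝ := fun ω => if ω ∈ G then 2 * L else 2 * Fintype.card β with hk
  have hkpos : ∀ ω, 0 < k ω := fun ω => by simp only [hk]; split_ifs <;> positivity
  -- The weights `1 / k` are chosen so that the ratios below have average at most one.
  have hratio : ∑ ω, (fiberCard V (V ω) / fiberCard P (P ω) / k ω : ℝ) ≤ Fintype.card Ω := by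
    have key : ∀ (T : Finset Ω) (B : ℝ),
        (∀ v, (((T.filter fun ω => V ω = v).image W).card : ℝ) ≤ B) →
        ∑ ω ∈ T, (fiberCard V (V ω) / fiberCard P (P ω) : ℝ) ≤ B * Fintype.card Ω := by
      intro T B hT
      calc ∑ ω ∈ T, (fiberCard V (V ω) / fiberCard P (P ω) : ℝ)
          = ∑ p ∈ T.image P, ∑ ω ∈ T with P ω = p,
              (fiberCard V (V ω) / fiberCard P (P ω) : ℝ) :=
            (Finset.sum_fiberwise_of_maps_to
              (fun ω hω => Finset.mem_image_of_mem P hω) _).symm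
        _ ≤ ∑ p ∈ T.image P, (fiberCard V p.1 : ℝ) := by
            refine Finset.sum_le_sum fun p hp => ?_
            obtain ⟨ω₀, -, rfl⟩ := Finset.mem_image.1 hp
            have h1 := fiberCard_pos P ω₀
            rw [Finset.sum_congr rfl
              (g := fun _ => (fiberCard V (V ω₀) / fiberCard P (P ω₀) : ℝ)) (fun ω hω => by
                have h2 := (Finset.mem_filter.1 hω).2
                rw [h2, (Prod.mk.inj h2).1])]
            rw [Finset.sum_const, nsmul_eq_mul, mul_div_assoc', div_le_iff₀ h1, mul_comm]
            refine mul_le_mul_of_nonneg_left ?_ (Nat.cast_nonneg _)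
            rw [fiberCard, Nat.cast_le]
            refine Finset.card_le_card fun ω hω => ?_
            simpa using (Finset.mem_filter.1 hω).2
        _ = ∑ v ∈ T.image V, ∑ p ∈ T.image P with p.1 = v, (fiberCard V p.1 : ℝ) := by
            refine (Finset.sum_fiberwise_of_maps_to (fun p hp => ?_) _).symm
            obtain ⟨ω, hω, rfl⟩ := Finset.mem_image.1 hp
            exact Finset.mem_image_of_mem V hω
        _ ≤ ∑ v ∈ T.image V, B * fiberCard V v := by
            refine Finset.sum_le_sum fun v _ => ?_
            rw [Finset.sum_congr rfl (g := fun _ => (fiberCard V v : ℝ)) (fun p hp => by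
              rw [(Finset.mem_filter.1 hp).2]), Finset.sum_const, nsmul_eq_mul]
            refine mul_le_mul_of_nonneg_right (le_trans ?_ (hT v)) (Nat.cast_nonneg _)
            rw [Nat.cast_le]
            refine Finset.card_le_card_of_injOn Prod.snd (fun p hp => ?_) (fun p hp q hq h => ?_)
            · obtain ⟨hp1, hp2⟩ := Finset.mem_filter.1 hp
              obtain ⟨ω, hω, rfl⟩ := Finset.mem_image.1 hp1
              exact Finset.mem_coe.2 (Finset.mem_image.2 ⟨ω, Finset.mem_filter.2 ⟨hω, hp2⟩, rfl⟩)
            · exact Prod.ext ((Finset.mem_filter.1 hp).2.trans (Finset.mem_filter.1 hq).2.symm) h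
        _ ≤ B * Fintype.card Ω := by
            have hB : 0 ≤ B := le_trans (Nat.cast_nonneg _) (hT (V (Classical.arbitrary Ω)))
            rw [← Finset.mul_sum]
            refine mul_le_mul_of_nonneg_left ?_ hB
            have := Finset.card_eq_sum_card_image V (Finset.univ : Finset Ω)
            rw [← Finset.card_univ, this]
            push_cast
            rw [show ∑ v ∈ Finset.univ.image V, ((Finset.univ.filter fun ω => V ω = v).card : ℝ) =
              ∑ v ∈ Finset.univ.image V, (fiberCard V v : ℝ) from
                Finset.sum_congr rfl fun v _ => by rw [fiberCard]; congr!]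
            refine Finset.sum_le_sum_of_subset_of_nonneg
              (Finset.image_subset_image (Finset.subset_univ T)) fun _ _ _ => Nat.cast_nonneg _
    rw [← Finset.sum_add_sum_compl G]
    have hg : ∑ ω ∈ G, (fiberCard V (V ω) / fiberCard P (P ω) / k ω : ℝ) ≤ Fintype.card Ω / 2 := by
      rw [Finset.sum_congr rfl (g := fun ω =>
        (fiberCard V (V ω) / fiberCard P (P ω) : ℝ) / (2 * L)) (fun ω hω => by simp [hk, hω]),
        ← Finset.sum_div, div_le_iff₀ (by positivity)]
      have := key G L hG
      linarith
    have hbad : ∑ ω ∈ Gᶜ, (fiberCard V (V ω) / fiberCard P (P ω) / k ω : ℝ) ≤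
        Fintype.card Ω / 2 := by
      rw [Finset.sum_congr rfl (g := fun ω =>
        (fiberCard V (V ω) / fiberCard P (P ω) : ℝ) / (2 * Fintype.card β)) (fun ω hω => by
          simp [hk, Finset.mem_compl.1 hω]),
        ← Finset.sum_div, div_le_iff₀ (by positivity)]
      have := key Gᶜ (Fintype.card β) (fun v => by exact_mod_cast Finset.card_le_univ _)
      linarith
    linarith
  have hlog := sum_log_le_zero _ (fun ω => by
    have := fiberCard_pos V ω
    have := fiberCard_pos P ω
    have := hkpos ω
    positivity) hratio
  have hksum : ∑ ω, Real.log (k ω) ≤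
      Fintype.card Ω * (Real.log (2 * L) + b * Real.log (2 * Fintype.card β)) := by
    have hlogM : 0 ≤ Real.log (2 * Fintype.card β) := Real.log_nonneg (by linarith)
    have hlogL : 0 ≤ Real.log (2 * L) := Real.log_nonneg (by linarith)
    calc ∑ ω, Real.log (k ω) ≤
        ∑ ω, (Real.log (2 * L) + if ω ∈ Gᶜ then Real.log (2 * Fintype.card β) else 0) := by
          refine Finset.sum_le_sum fun ω _ => ?_
          by_cases hω : ω ∈ G
          · simp [hk, hω]
          · simp [hk, hω, hlogL]
      _ = Fintype.card Ω * Real.log (2 * L) + (Gᶜ).card * Real.log (2 * Fintype.card β) := by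
          rw [Finset.sum_add_distrib, Finset.sum_ite_mem, Finset.univ_inter]
          simp
      _ ≤ _ := by
          have := mul_le_mul_of_nonneg_right hb hlogM
          nlinarith
  refine le_of_mul_le_mul_left ?_ h0
  refine le_trans ?_ hksum
  rw [mul_sub, card_mul_entropy, card_mul_entropy, ← Finset.sum_sub_distrib, ← sub_nonpos,
    ← Finset.sum_sub_distrib]
  refine le_trans (le_of_eq (Finset.sum_congr rfl fun ω _ => ?_)) hlog
  have h1 := (fiberCard_pos V ω).ne'
  have h2 := (fiberCard_pos P ω).ne'
  rw [Real.log_div h0.ne' h2, Real.log_div h0.ne' h1, Real.log_div (div_ne_zero h1 h2)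
    (hkpos ω).ne', Real.log_div h1 h2]
  ring

end Entropy

/-! ### Sums of independent variables -/

section Sumset

universe u

variable {A B C : Type u} [Fintype A] [Fintype B] [Fintype C]
  {α β γ : Type*} {G : Type*} [AddCommGroup G]

/-- The sum of independent copies of the `G`-valued variables `X` and `Y`. -/
def indepSum (X : A → G) (Y : B → G) : A × B → G := fun p => X p.1 + Y p.2

lemma entropy_add_le_prodMap [Nonempty A] [Nonempty B] (f : A → α) (g : B → β) :
    entropy f + entropy g ≤ entropy (fun p : A × B => (f p.1, g p.2)) := by
  rw [← entropy_comp_fst (Ω' := B) f, ← entropy_comp_snd (Ω' := A) g]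
  refine entropy_add_le_prod _ _ (fun a b => (a.1, b.2)) (fun _ _ => rfl) (fun _ _ => rfl) ?_
  rintro ⟨⟨a, b⟩, c, d⟩ ⟨⟨a', b'⟩, c', d'⟩ h
  simp only [Prod.mk.injEq] at h ⊢
  tauto

lemma entropy_add_add_le_prodMap [Nonempty A] [Nonempty B] [Nonempty C]
    (f : A → α) (g : B → β) (h : C → γ) :
    entropy f + entropy g + entropy h ≤
      entropy (fun p : A × B × C => (f p.1, g p.2.1, h p.2.2)) := by
  have h1 := entropy_add_le_prodMap f fun p : B × C => (g p.1, h p.2)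
  have h2 := entropy_add_le_prodMap g h
  linarith

lemma entropy_comp_prod12 [Nonempty C] (F : A × B → α) :
    entropy (fun p : A × B × C => F (p.1, p.2.1)) = entropy F :=
  (entropy_comp_equiv (Equiv.prodAssoc A B C).symm fun q => F q.1).trans (entropy_comp_fst F)

lemma entropy_comp_prod13 [Nonempty B] (F : A × C → α) :
    entropy (fun p : A × B × C => F (p.1, p.2.2)) = entropy F :=
  (entropy_comp_equiv ((Equiv.refl A).prodCongr (Equiv.prodComm B C))
    fun q : A × C × B => F (q.1, q.2.1)).trans (entropy_comp_prod12 F)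

lemma entropy_le_indepSum [Nonempty A] [Nonempty B] (X : A → G) (Y : B → G) :
    entropy X ≤ entropy (indepSum X Y) := by
  have h1 := entropy_add_le_prodMap X Y
  have h2 := entropy_prod_le (indepSum X Y) (fun p : A × B => Y p.2)
  rw [entropy_comp_snd] at h2
  have h3 := entropy_mono (fun p : A × B => (X p.1, Y p.2))
    (fun p => (indepSum X Y p, Y p.2)) fun p q h => by
      simp only [indepSum, Prod.mk.injEq] at h ⊢
      refine ⟨?_, h.2⟩
      rw [h.2] at h
      exact add_right_cancel h.1
  linarith

lemma entropy_indepSum_comm (X : A → G) (Y : B → G) :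
    entropy (indepSum X Y) = entropy (indepSum Y X) := by
  rw [← entropy_comp_equiv (Equiv.prodComm A B) (indepSum Y X)]
  congr 1
  funext p
  exact add_comm _ _

lemma entropy_neg {Ω : Type*} [Fintype Ω] (X : Ω → G) : entropy (-X) = entropy X :=
  entropy_congr _ _ fun ω ω' => by simp

/-- The sumset inequality of Kaimanovich, Vershik and Madiman: adding `X` increases the entropy of
`Y + Z` by no more than it increases that of `Z`. -/
lemma entropy_add_add_le {Ω : Type*} [Fintype Ω] [Nonempty Ω] (X Y Z : Ω → G)
    (h : entropy X + entropy Y + entropy Z ≤ entropy fun ω => (X ω, Y ω, Z ω)) :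
    entropy (X + Y + Z) + entropy Z ≤ entropy (X + Z) + entropy (Y + Z) := by
  have h1 := entropy_submodular (fun ω => (X ω, (Y + Z) ω)) (fun ω => (Y ω, (X + Z) ω))
    (X + Y + Z) (fun ω ω' h => by
      simp only [Prod.mk.injEq, Pi.add_apply] at h ⊢
      rw [add_assoc, add_assoc, h.1, h.2]) (fun ω ω' h => by
      simp only [Prod.mk.injEq, Pi.add_apply] at h ⊢
      rw [add_right_comm, add_right_comm (X ω'), h.1, h.2])
  have h2 := entropy_prod_le X (Y + Z)
  have h3 := entropy_prod_le Y (X + Z)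
  have h4 := entropy_mono (fun ω => (X ω, Y ω, Z ω))
    (fun ω => ((X ω, (Y + Z) ω), (Y ω, (X + Z) ω))) fun ω ω' h => by
      simp only [Prod.mk.injEq, Pi.add_apply] at h ⊢
      obtain ⟨⟨h1, h2⟩, h3, h4⟩ := h
      rw [h3] at h2
      exact ⟨h1, h3, add_left_cancel h2⟩
  linarith

lemma entropy_indepSum_indepSum_le [Nonempty A] [Nonempty B] [Nonempty C]
    (X : A → G) (Y : B → G) (Z : C → G) :
    entropy (indepSum X (indepSum Y Z)) + entropy Z ≤
      entropy (indepSum X Z) + entropy (indepSum Y Z) := by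
  have h := entropy_add_add_le (fun p : A × B × C => X p.1) (fun p => Y p.2.1) (fun p => Z p.2.2)
  have eX : entropy (fun p : A × B × C => X p.1) = entropy X := entropy_comp_fst X
  have eY : entropy (fun p : A × B × C => Y p.2.1) = entropy Y :=
    (entropy_comp_snd fun q : B × C => Y q.1).trans (entropy_comp_fst Y)
  have eZ : entropy (fun p : A × B × C => Z p.2.2) = entropy Z :=
    (entropy_comp_snd fun q : B × C => Z q.2).trans (entropy_comp_snd Z)
  rw [eX, eY, eZ] at h
  have h := h (entropy_add_add_le_prodMap X Y Z)
  have e1 : entropy ((fun p : A × B × C => X p.1) + fun p => Z p.2.2) = entropy (indepSum X Z) :=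
    entropy_comp_prod13 (indepSum X Z)
  have e2 : entropy ((fun p : A × B × C => Y p.2.1) + fun p => Z p.2.2) = entropy (indepSum Y Z) :=
    entropy_comp_snd (indepSum Y Z)
  rw [e1, e2] at h
  have e3 : ((fun p : A × B × C => X p.1) + (fun p => Y p.2.1) + fun p => Z p.2.2) =
      indepSum X (indepSum Y Z) := by
    funext p
    simp [indepSum, add_assoc]
  rwa [e3] at h

/-- The entropic Ruzsa triangle inequality. -/
lemma entropy_indepSum_neg_le [Nonempty A] [Nonempty B] [Nonempty C]
    (X : A → G) (Y : B → G) (Z : C → G) :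
    entropy (indepSum X (-Y)) + entropy Z ≤ entropy (indepSum X Z) + entropy (indepSum Y Z) := by
  have h1 := entropy_submodular (fun p : A × B × C => (X p.1, Y p.2.1))
    (fun p => (indepSum X Z (p.1, p.2.2), indepSum Y Z p.2))
    (fun p => indepSum X (-Y) (p.1, p.2.1)) (fun p q h => by
      simp only [Prod.mk.injEq] at h
      simp [indepSum, h.1, h.2]) (fun p q h => by
      simp only [Prod.mk.injEq, indepSum, Pi.neg_apply] at h ⊢
      have : ∀ r : A × B × C, X r.1 + -Y r.2.1 = (X r.1 + Z r.2.2) - (Y r.2.1 + Z r.2.2) :=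
        fun r => by abel
      rw [this, this, h.1, h.2])
  have h2 := entropy_prod_le (fun p : A × B × C => indepSum X Z (p.1, p.2.2))
    (fun p => indepSum Y Z p.2)
  rw [entropy_comp_prod13 (indepSum X Z), entropy_comp_snd (indepSum Y Z)] at h2
  rw [entropy_comp_prod12 (indepSum X (-Y)),
    entropy_comp_prod12 (fun q : A × B => (X q.1, Y q.2))] at h1
  have h3 := entropy_prod_le (fun q : A × B => X q.1) (fun q => Y q.2)
  rw [entropy_comp_fst, entropy_comp_snd] at h3
  have h4 := entropy_add_add_le_prodMap X Y Z
  have h5 := entropy_mono (fun p : A × B × C => (X p.1, Y p.2.1, Z p.2.2))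
    (fun p => ((X p.1, Y p.2.1), (indepSum X Z (p.1, p.2.2), indepSum Y Z p.2))) fun p q h => by
      simp only [Prod.mk.injEq, indepSum] at h ⊢
      obtain ⟨⟨h1, h2⟩, h3, -⟩ := h
      rw [h1] at h3
      exact ⟨h1, h2, add_left_cancel h3⟩
  linarith

/-- Increasing a dilation factor by one. The identity behind it is
`(p + 1) X + Y = p (X - X') + (X + p X' + Y)`, with `X'` an independent copy of `X`. -/
lemma entropy_succ_smul_indepSum_le [Nonempty A] [Nonempty B] (X : A → G) (Y : B → G) (p : ℕ) :
    entropy (indepSum ((p + 1) • X) Y) + entropy X ≤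
      entropy (indepSum X (-X)) + entropy (indepSum (p • X) (indepSum X Y)) := by
  have h1 := entropy_submodular (fun w : A × A × B => (X w.1, Y w.2.2))
    (fun w => (indepSum X (-X) (w.1, w.2.1), indepSum (p • X) (indepSum X Y) (w.2.1, w.1, w.2.2)))
    (fun w => indepSum ((p + 1) • X) Y (w.1, w.2.2)) (fun w v h => by
      simp only [Prod.mk.injEq] at h
      simp [indepSum, h.1, h.2]) (fun w v h => by
      simp only [Prod.mk.injEq, indepSum, Pi.neg_apply, Pi.smul_apply] at h ⊢
      have : ∀ r : A × A × B, (p + 1) • X r.1 + Y r.2.2 =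
          p • (X r.1 + -X r.2.1) + (p • X r.2.1 + (X r.1 + Y r.2.2)) := fun r => by
        rw [add_smul, one_smul, smul_add, smul_neg]
        abel
      rw [this, this, h.1, h.2])
  have h2 := entropy_prod_le (fun w : A × A × B => indepSum X (-X) (w.1, w.2.1))
    (fun w => indepSum (p • X) (indepSum X Y) (w.2.1, w.1, w.2.2))
  have e1 : entropy (fun w : A × A × B => indepSum (p • X) (indepSum X Y) (w.2.1, w.1, w.2.2)) =
      entropy (indepSum (p • X) (indepSum X Y)) :=
    entropy_comp_equiv (⟨fun w => (w.2.1, w.1, w.2.2), fun w => (w.2.1, w.1, w.2.2),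
      fun _ => rfl, fun _ => rfl⟩ : A × A × B ≃ A × A × B) _
  rw [entropy_comp_prod12 (indepSum X (-X)), e1] at h2
  rw [entropy_comp_prod13 (indepSum ((p + 1) • X) Y),
    entropy_comp_prod13 (fun q : A × B => (X q.1, Y q.2))] at h1
  have h3 := entropy_prod_le (fun q : A × B => X q.1) (fun q => Y q.2)
  rw [entropy_comp_fst, entropy_comp_snd] at h3
  have h4 := entropy_add_add_le_prodMap X X Y
  have h5 := entropy_mono (fun w : A × A × B => (X w.1, X w.2.1, Y w.2.2))
    (fun w => ((X w.1, Y w.2.2),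
      (indepSum X (-X) (w.1, w.2.1), indepSum (p • X) (indepSum X Y) (w.2.1, w.1, w.2.2))))
    fun w v h => by
      simp only [Prod.mk.injEq, indepSum, Pi.neg_apply] at h ⊢
      obtain ⟨⟨h1, h2⟩, h3, -⟩ := h
      rw [h1] at h3
      exact ⟨h1, neg_injective (add_left_cancel h3), h2⟩
  linarith

/-- A dilate of a variable `X` with small self-difference `X - X'` that increases the entropy of
the pivot `Y` only slightly also increases the entropy of `Z + Y` only slightly. -/
lemma entropy_smul_indepSum_le [Nonempty A] [Nonempty B] (X : A → G) (Y : B → G) (D : ℝ)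
    (hD : entropy (indepSum X (-X)) - entropy X + (entropy (indepSum X Y) - entropy Y) ≤ D)
    (p : ℕ) : ∀ {C : Type u} [Fintype C] [Nonempty C] (Z : C → G),
      entropy (indepSum (p • X) (indepSum Z Y)) ≤ p * D + entropy (indepSum Z Y) := by
  induction p with
  | zero =>
    intro C _ _ Z
    have : indepSum (0 • X) (indepSum Z Y) = fun q => indepSum Z Y q.2 := by
      funext q
      simp [indepSum]
    rw [this, entropy_comp_snd]
    simp
  | succ p ih =>
    intro C _ _ Z
    have h1 := entropy_succ_smul_indepSum_le X (indepSum Z Y) p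
    have h2 := ih (indepSum X Z)
    have h3 := entropy_indepSum_indepSum_le X Z Y
    have e1 : entropy (indepSum (p • X) (indepSum X (indepSum Z Y))) =
        entropy (indepSum (p • X) (indepSum (indepSum X Z) Y)) := by
      rw [← entropy_comp_equiv ((Equiv.refl A).prodCongr (Equiv.prodAssoc A C B))]
      congr 1
      funext q
      simp [indepSum, add_assoc]
    have e2 : entropy (indepSum X (indepSum Z Y)) = entropy (indepSum (indepSum X Z) Y) := by
      rw [← entropy_comp_equiv (Equiv.prodAssoc A C B)]
      congr 1
      funext q
      simp [indepSum, add_assoc]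
    push_cast
    linarith

/-- If the sum of independent `X` and `Y` has hardly more entropy than each summand, then the same
holds for every integer combination of `X` and `Y`. -/
lemma entropy_zsmul_indepSum_zsmul_le [Nonempty A] [Nonempty B] (X : A → G) (Y : B → G)
    (c d : ℤ) :
    entropy (indepSum (c • X) (d • Y)) ≤ entropy Y + (c.natAbs + d.natAbs : ℝ) *
      (3 * (2 * entropy (indepSum X Y) - entropy X - entropy Y)) := by
  have a0 := entropy_le_indepSum X Y
  have b0 := entropy_le_indepSum Y X
  rw [entropy_indepSum_comm Y X] at b0
  have hXX := entropy_indepSum_neg_le X X Y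
  have hYY := entropy_indepSum_neg_le Y Y X
  rw [entropy_indepSum_comm Y X] at hYY
  have hYY' : entropy (indepSum Y Y) + entropy X ≤ 2 * entropy (indepSum X Y) := by
    have h1 := entropy_indepSum_indepSum_le Y Y X
    have h2 : entropy (indepSum Y Y) ≤ entropy (indepSum Y (indepSum Y X)) := by
      refine (entropy_le_indepSum (indepSum Y Y) X).trans (le_of_eq ?_)
      rw [← entropy_comp_equiv (Equiv.prodAssoc B B A)]
      congr 1
      funext q
      simp [indepSum, add_assoc]
    rw [entropy_indepSum_comm Y X] at h1
    linarith
  have hXY := entropy_indepSum_neg_le X Y Y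
  have hnXX : entropy (indepSum (-X) (- -X)) = entropy (indepSum X (-X)) := by
    rw [neg_neg, entropy_indepSum_comm]
  have hnYY : entropy (indepSum (-Y) (- -Y)) = entropy (indepSum Y (-Y)) := by
    rw [neg_neg, entropy_indepSum_comm]
  have hnXY : entropy (indepSum (-X) Y) = entropy (indepSum X (-Y)) := by
    rw [← entropy_neg (indepSum X (-Y))]
    congr 1
    funext q
    simp [indepSum, add_comm]
  have hnYY2 : entropy (indepSum (-Y) Y) = entropy (indepSum Y (-Y)) := entropy_indepSum_comm _ _
  set D := 3 * (2 * entropy (indepSum X Y) - entropy X - entropy Y) with hD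
  have hX : ∀ {C : Type u} [Fintype C] [Nonempty C] (Z : C → G),
      entropy (indepSum (c • X) (indepSum Z Y)) ≤ c.natAbs * D + entropy (indepSum Z Y) := by
    intro C _ _ Z
    rcases Int.natAbs_eq c with h | h
    · have := entropy_smul_indepSum_le X Y D (by linarith) c.natAbs Z
      rwa [← natCast_zsmul, ← h] at this
    · have := entropy_smul_indepSum_le (-X) Y D
        (by rw [hnXX, hnXY, entropy_neg]; linarith) c.natAbs Z
      rwa [← natCast_zsmul, smul_neg, ← neg_smul, ← h] at this
  have hY : ∀ {C : Type u} [Fintype C] [Nonempty C] (Z : C → G),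
      entropy (indepSum (d • Y) (indepSum Z Y)) ≤ d.natAbs * D + entropy (indepSum Z Y) := by
    intro C _ _ Z
    rcases Int.natAbs_eq d with h | h
    · have := entropy_smul_indepSum_le Y Y D (by linarith) d.natAbs Z
      rwa [← natCast_zsmul, ← h] at this
    · have := entropy_smul_indepSum_le (-Y) Y D
        (by rw [hnYY, hnYY2, entropy_neg]; linarith) d.natAbs Z
      rwa [← natCast_zsmul, smul_neg, ← neg_smul, ← h] at this
  have h1 := hX (d • Y)
  have h2 := hY (fun _ : PUnit.{u + 1} => (0 : G))
  have e1 : entropy (indepSum (fun _ : PUnit.{u + 1} => (0 : G)) Y) = entropy Y := by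
    rw [← entropy_comp_snd (Ω' := PUnit.{u + 1}) Y]
    congr 1
    funext q
    simp [indepSum]
  have e2 : entropy (indepSum (d • Y) (indepSum (fun _ : PUnit.{u + 1} => (0 : G)) Y)) =
      entropy (indepSum (d • Y) Y) := by
    rw [← entropy_comp_prod13 (B := PUnit.{u + 1}) (indepSum (d • Y) Y)]
    congr 1
    funext q
    simp [indepSum]
  have h3 : entropy (indepSum (c • X) (d • Y)) ≤
      entropy (indepSum (c • X) (indepSum (d • Y) Y)) := by
    refine (entropy_le_indepSum _ Y).trans (le_of_eq ?_)
    rw [← entropy_comp_equiv (Equiv.prodAssoc A B B)]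
    congr 1
    funext q
    simp [indepSum, add_assoc]
  rw [add_mul]
  linarith

lemma entropy_zsmul {Ω : Type*} [Fintype Ω] [IsAddTorsionFree G] (X : Ω → G) {a : ℤ}
    (ha : a ≠ 0) : entropy (a • X) = entropy X :=
  entropy_congr _ _ fun ω ω' => by
    simpa using ((smul_right_injective G ha).eq_iff (a := X ω) (b := X ω')).symm

/-- If `a X + b Y` has hardly more entropy than `X` and `Y`, then the same holds for `c X + d Y`:
apply the previous lemma to `a X` and `b Y`, since `a b (c X + d Y) = b c (a X) + a d (b Y)`. -/
lemma entropy_combination_le [Nonempty A] [Nonempty B] [IsAddTorsionFree G] (X : A → G) (Y : B → G)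
    {a b : ℤ} (ha : a ≠ 0) (hb : b ≠ 0) (c d : ℤ) :
    entropy (indepSum (c • X) (d • Y)) ≤ entropy Y + ((b * c).natAbs + (a * d).natAbs : ℝ) *
      (3 * (2 * entropy (indepSum (a • X) (b • Y)) - entropy X - entropy Y)) := by
  have h := entropy_zsmul_indepSum_zsmul_le (a • X) (b • Y) (b * c) (a * d)
  rw [entropy_zsmul X ha, entropy_zsmul Y hb] at h
  refine le_trans (le_of_eq ?_) h
  rw [← entropy_zsmul (indepSum (c • X) (d • Y)) (mul_ne_zero ha hb)]
  congr 1
  funext q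
  simp only [indepSum, Pi.smul_apply, smul_add, smul_smul]
  congr 2 <;> ring

end Sumset

/-! ### Decoding in Gaussian noise -/

section Gaussian

lemma measure_pi_mono {ι : Type*} [Fintype ι] {X : ι → Type*} [∀ i, MeasurableSpace (X i)]
    {μ ν : ∀ i, Measure (X i)} (h : ∀ i, μ i ≤ ν i) : Measure.pi μ ≤ Measure.pi ν := by
  refine Measure.le_iff.2 fun s hs => ?_
  rw [Measure.pi_def, Measure.pi_def, toMeasure_apply _ _ hs, toMeasure_apply _ _ hs]
  refine OuterMeasure.le_pi.2 (fun t _ => ?_) s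
  exact (OuterMeasure.pi_pi_le _ t).trans
    (Finset.prod_le_prod' fun i _ => Measure.le_iff'.1 (h i) (t i))

/-- The loss incurred when a standard Gaussian, shifted by at most `r`, is dominated by
a multiple of a Gaussian of variance `2`. -/
noncomputable def shiftLoss (r : ℝ) : ℝ := √2 * Real.exp (r ^ 2 / 2)

lemma one_le_shiftLoss (r : ℝ) : 1 ≤ shiftLoss r := by
  have h1 : (1 : ℝ) ≤ √2 := Real.one_le_sqrt.2 (by norm_num)
  have h2 : (1 : ℝ) ≤ Real.exp (r ^ 2 / 2) := Real.one_le_exp (by positivity)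
  exact one_le_mul_of_one_le_of_one_le h1 h2

lemma gaussianReal_le_smul {m c r : ℝ} (h : |m - c| ≤ r) :
    gaussianReal m 1 ≤ (shiftLoss r).toNNReal • gaussianReal c 2 := by
  rw [gaussianReal_of_var_ne_zero _ one_ne_zero, gaussianReal_of_var_ne_zero _ two_ne_zero,
    show (shiftLoss r).toNNReal • volume.withDensity (gaussianPDF c 2) =
      ((shiftLoss r).toNNReal : ℝ≥0∞) • volume.withDensity (gaussianPDF c 2) from rfl,
    ← withDensity_smul _ (measurable_gaussianPDF c 2)]
  refine withDensity_mono (ae_of_all _ fun y => ?_)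
  rw [Pi.smul_apply, smul_eq_mul, gaussianPDF, gaussianPDF, ENNReal.ofNNReal_toNNReal,
    ← ENNReal.ofReal_mul (zero_le_one.trans (one_le_shiftLoss r))]
  refine ENNReal.ofReal_le_ofReal ?_
  have hr : (m - c) ^ 2 ≤ r ^ 2 := sq_le_sq' (by linarith [neg_abs_le (m - c)])
    ((le_abs_self _).trans h)
  simp only [gaussianPDFReal, NNReal.coe_one, NNReal.coe_ofNat, shiftLoss, mul_one]
  have e1 : √(2 * Real.pi * 2) = √2 * √(2 * Real.pi) := by
    rw [mul_comm, Real.sqrt_mul (by norm_num)]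
  have hpos : 0 < √(2 * Real.pi) := Real.sqrt_pos.2 (by positivity)
  have h2 : 0 < √(2 : ℝ) := by positivity
  rw [e1, mul_inv]
  calc (√(2 * Real.pi))⁻¹ * Real.exp (-(y - m) ^ 2 / 2)
      ≤ (√(2 * Real.pi))⁻¹ * Real.exp (r ^ 2 / 2 + -(y - c) ^ 2 / (2 * 2)) := by
        refine mul_le_mul_of_nonneg_left (Real.exp_le_exp.2 ?_) (by positivity)
        nlinarith [sq_nonneg ((y - m) - (m - c))]
    _ = _ := by
        rw [Real.exp_add]
        field_simp

/-- Signals that lie within distance `r` of each other in each coordinate can be decoded reliably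
only if they carry at most `2 * shiftLoss r ^ n` messages: after the shifts, all noise laws are
dominated by one measure of total mass `shiftLoss r ^ n`. -/
lemma card_image_le_of_decoded {Ω M : Type*} [DecidableEq M] [MeasurableSpace M]
    [MeasurableSingletonClass M] {n : ℕ} (g : (Fin n → ℝ) → M) (hg : Measurable g) (T : Finset Ω)
    (s : Ω → Fin n → ℝ) (W : Ω → M) (c : Fin n → ℝ) (r : ℝ)
    (hs : ∀ ω ∈ T, ∀ t, |s ω t - c t| ≤ r)
    (hT : ∀ ω ∈ T, 1 / 2 ≤
      (Measure.pi fun _ : Fin n => gaussianReal 0 1) {z | g (fun t => z t + s ω t) = W ω}) :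
    ((T.image W).card : ℝ) ≤ 2 * shiftLoss r ^ n := by
  set Λ : Measure (Fin n → ℝ) :=
    Measure.pi fun t => (shiftLoss r).toNNReal • gaussianReal (c t) 2 with hΛ
  have hΛuniv : Λ Set.univ = ENNReal.ofReal (shiftLoss r ^ n) := by
    rw [hΛ, Measure.pi_univ]
    rw [ENNReal.ofReal_pow (zero_le_one.trans (one_le_shiftLoss r))]
    simp only [Measure.smul_apply, measure_univ, Finset.prod_const, Finset.card_univ,
      Fintype.card_fin, ENNReal.smul_def, smul_eq_mul, mul_one, ENNReal.ofReal]
  have hmass : ∀ m ∈ T.image W, 1 / 2 ≤ Λ (g ⁻¹' {m}) := by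
    intro m hm
    obtain ⟨ω, hω, rfl⟩ := Finset.mem_image.1 hm
    refine (hT ω hω).trans ?_
    have hmeas : Measurable fun (z : Fin n → ℝ) t => z t + s ω t := by fun_prop
    have h1 : {z : Fin n → ℝ | g (fun t => z t + s ω t) = W ω} =
        (fun (z : Fin n → ℝ) t => z t + s ω t) ⁻¹' (g ⁻¹' {W ω}) := rfl
    rw [h1, ← Measure.map_apply hmeas (hg (measurableSet_singleton _))]
    have h2 : (Measure.pi fun _ : Fin n => gaussianReal 0 1).map
        (fun (z : Fin n → ℝ) t => z t + s ω t) = Measure.pi fun t => gaussianReal (s ω t) 1 := by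
      have := Measure.pi_map_pi (μ := fun _ : Fin n => gaussianReal 0 1)
        (f := fun t x => x + s ω t)
        (hμ := fun t => by rw [gaussianReal_map_add_const]; infer_instance)
        (fun t => by fun_prop)
      rw [this]
      simp only [gaussianReal_map_add_const, zero_add]
    rw [h2]
    exact Measure.le_iff'.1 (measure_pi_mono fun t => gaussianReal_le_smul (hs ω hω t)) _
  have hsum : ((T.image W).card : ℝ≥0∞) * (1 / 2) ≤ ENNReal.ofReal (shiftLoss r ^ n) := by
    rw [← hΛuniv, ← nsmul_eq_mul]
    calc (T.image W).card • (1 / 2 : ℝ≥0∞) ≤ ∑ m ∈ T.image W, Λ (g ⁻¹' {m}) :=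
          Finset.card_nsmul_le_sum _ _ _ hmass
      _ = Λ (g ⁻¹' ↑(T.image W)) :=
          sum_measure_preimage_singleton _ fun m _ => hg (measurableSet_singleton m)
      _ ≤ Λ Set.univ := measure_mono (Set.subset_univ _)
  have hC : 0 ≤ shiftLoss r ^ n := pow_nonneg (zero_le_one.trans (one_le_shiftLoss r)) n
  have h3 := ENNReal.toReal_mono ENNReal.ofReal_ne_top hsum
  rw [ENNReal.toReal_ofReal hC] at h3
  simp at h3
  linarith

end Gaussian

/-! ### Integer points -/

section Lattice

lemma sum_exp_neg_abs_le {B : ℝ} (hB : 1 ≤ B) (N : ℕ) :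
    ∑ k ∈ Finset.Icc (-N : ℤ) N, Real.exp (-(|(k : ℝ)| / B)) ≤ 4 * B := by
  classical
  have hB0 : 0 < B := by linarith
  set q := Real.exp (-(1 / B)) with hq
  have hq1 : q < 1 := by
    rw [hq, ← Real.exp_zero, Real.exp_lt_exp, neg_lt_zero]
    positivity
  have hpow : ∀ k : ℕ, Real.exp (-((k : ℝ) / B)) = q ^ k := fun k => by
    rw [hq, ← Real.exp_nat_mul]
    congr 1
    ring
  have hgeom : ∑ k ∈ Finset.range (N + 1), q ^ k ≤ 2 * B := by
    have hq0 : 0 < q := Real.exp_pos _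
    have h0 : ∑ k ∈ Finset.range (N + 1), q ^ k ≤ (1 - q)⁻¹ := by
      rw [geom_sum_eq hq1.ne, ← neg_div_neg_eq, neg_sub, neg_sub, div_eq_mul_inv]
      refine mul_le_of_le_one_left (inv_nonneg.2 (by linarith)) ?_
      linarith [pow_pos hq0 (N + 1)]
    refine h0.trans ?_
    have h1 : (1 : ℝ) / B + 1 ≤ Real.exp (1 / B) := Real.add_one_le_exp _
    have h2 : q ≤ B / (B + 1) := by
      rw [hq, Real.exp_neg, inv_le_comm₀ (Real.exp_pos _) (by positivity), inv_div]
      refine le_trans (le_of_eq ?_) h1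
      field_simp
      ring
    have h3 : 1 / (B + 1) ≤ 1 - q := by
      have : 1 / (B + 1) = 1 - B / (B + 1) := by field_simp; ring
      linarith
    calc (1 - q)⁻¹ ≤ (1 / (B + 1))⁻¹ := inv_anti₀ (by positivity) h3
      _ ≤ 2 * B := by rw [one_div, inv_inv]; linarith
  have hsub : Finset.Icc (-N : ℤ) N ⊆ (Finset.range (N + 1)).image (fun k : ℕ => (k : ℤ)) ∪
      (Finset.range (N + 1)).image (fun k : ℕ => -(k : ℤ)) := by
    intro k hk
    rw [Finset.mem_Icc] at hk
    simp only [Finset.mem_union, Finset.mem_image, Finset.mem_range]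
    rcases Int.natAbs_eq k with h | h
    · exact Or.inl ⟨k.natAbs, by omega, h.symm⟩
    · exact Or.inr ⟨k.natAbs, by omega, h.symm⟩
  calc _ ≤ ∑ k ∈ (Finset.range (N + 1)).image (fun k : ℕ => (k : ℤ)) ∪
      (Finset.range (N + 1)).image (fun k : ℕ => -(k : ℤ)), Real.exp (-(|(k : ℝ)| / B)) :=
        Finset.sum_le_sum_of_subset_of_nonneg hsub fun _ _ _ => (Real.exp_pos _).le
    _ ≤ ∑ k ∈ (Finset.range (N + 1)).image (fun k : ℕ => (k : ℤ)), Real.exp (-(|(k : ℝ)| / B)) +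
        ∑ k ∈ (Finset.range (N + 1)).image (fun k : ℕ => -(k : ℤ)),
          Real.exp (-(|(k : ℝ)| / B)) := by
        rw [← Finset.sum_union_inter]
        exact le_add_of_nonneg_right (Finset.sum_nonneg fun _ _ => (Real.exp_pos _).le)
    _ ≤ 2 * B + 2 * B := by
        rw [Finset.sum_image (Nat.cast_injective.injOn),
          Finset.sum_image ((show Function.Injective fun k : ℕ => -(k : ℤ) from
            neg_injective.comp Nat.cast_injective).injOn)]
        refine add_le_add (le_of_eq_of_le ?_ hgeom) (le_of_eq_of_le ?_ hgeom) <;>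
        · refine Finset.sum_congr rfl fun k _ => ?_
          rw [← hpow]
          simp
    _ = 4 * B := by ring

/-- The number of integer points in the cross-polytope `∑ |v t| ≤ n B`: weight each point by
`exp (-∑ |v t| / B)`, so that the total weight factors over the coordinates. -/
lemma card_le_of_sum_abs_le {n : ℕ} {B : ℝ} (hB : 1 ≤ B) (S : Finset (Fin n → ℤ))
    (hS : ∀ v ∈ S, ∑ t, |(v t : ℝ)| ≤ n * B) : (S.card : ℝ) ≤ (Real.exp 1 * (4 * B)) ^ n := by
  classical
  have hB0 : 0 < B := by linarith
  obtain ⟨N, hN⟩ := exists_nat_ge (n * B)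
  have hsub : S ⊆ Fintype.piFinset fun _ : Fin n => Finset.Icc (-N : ℤ) N := by
    intro v hv
    refine Fintype.mem_piFinset.2 fun t => ?_
    have h1 : |(v t : ℝ)| ≤ N := ((Finset.single_le_sum (f := fun t => |(v t : ℝ)|)
      (fun _ _ => abs_nonneg _) (Finset.mem_univ t)).trans (hS v hv)).trans hN
    have h2 : |v t| ≤ (N : ℤ) := by exact_mod_cast h1
    rw [Finset.mem_Icc]
    exact abs_le.1 h2
  have hweight : ∀ v ∈ S, Real.exp (-n) ≤ ∏ t, Real.exp (-(|(v t : ℝ)| / B)) := by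
    intro v hv
    rw [← Real.exp_sum, Real.exp_le_exp, Finset.sum_neg_distrib, neg_le_neg_iff, ← Finset.sum_div,
      div_le_iff₀ hB0]
    exact hS v hv
  have h1 : S.card * Real.exp (-n) ≤ (4 * B) ^ n := by
    calc S.card * Real.exp (-n) = ∑ _v ∈ S, Real.exp (-n) := by simp
      _ ≤ ∑ v ∈ S, ∏ t, Real.exp (-(|(v t : ℝ)| / B)) := Finset.sum_le_sum hweight
      _ ≤ ∑ v ∈ Fintype.piFinset fun _ : Fin n => Finset.Icc (-N : ℤ) N,
            ∏ t, Real.exp (-(|(v t : ℝ)| / B)) :=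
          Finset.sum_le_sum_of_subset_of_nonneg hsub fun _ _ _ =>
            Finset.prod_nonneg fun _ _ => (Real.exp_pos _).le
      _ = ∏ _t : Fin n, ∑ k ∈ Finset.Icc (-N : ℤ) N, Real.exp (-(|(k : ℝ)| / B)) :=
          (Finset.prod_univ_sum (fun _ : Fin n => Finset.Icc (-N : ℤ) N)
            fun _ k => Real.exp (-(|(k : ℝ)| / B))).symm
      _ ≤ (4 * B) ^ n := by
          rw [Finset.prod_const, Finset.card_univ, Fintype.card_fin]
          exact pow_le_pow_left₀ (Finset.sum_nonneg fun _ _ => (Real.exp_pos _).le)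
            (sum_exp_neg_abs_le hB N) n
  rw [mul_pow, ← Real.exp_nat_mul, mul_one]
  calc (S.card : ℝ) = Real.exp n * (S.card * Real.exp (-n)) := by
        rw [mul_left_comm, ← Real.exp_add, add_neg_cancel, Real.exp_zero, mul_one]
    _ ≤ _ := mul_le_mul_of_nonneg_left h1 (Real.exp_pos _).le

end Lattice

/-! ### Sums over subsets of the users -/

section Users

variable {ι : Type*} {M : ι → Type*} {α β : Type*} {G : Type*} [AddCommGroup G]

/-- The sum of the signals `X i` over the users `i` in `s`, as a function of all messages. -/
def partialSum (X : ∀ i, M i → G) (s : Finset ι) : (∀ i, M i) → G := fun ω => ∑ i ∈ s, X i (ω i)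

lemma partialSum_congr (X : ∀ i, M i → G) (s : Finset ι) (ω ω' : ∀ i, M i)
    (h : ∀ i ∈ s, ω i = ω' i) : partialSum X s ω = partialSum X s ω' :=
  Finset.sum_congr rfl fun i hi => by rw [h i hi]

variable [DecidableEq ι]

lemma partialSum_union (X : ∀ i, M i → G) (s u : Finset ι) (hsu : Disjoint s u) :
    partialSum X (s ∪ u) = partialSum X s + partialSum X u := by
  funext ω
  exact Finset.sum_union hsu

variable [Fintype ι] [∀ i, Fintype (M i)]

lemma fiberCard_restrict (s : Finset ι) (π : (∀ i, M i) → α)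
    (hπ : ∀ ω ω', π ω = π ω' ↔ ∀ i ∈ s, ω i = ω' i) (ω : ∀ i, M i) :
    fiberCard π (π ω) = ∏ i, if i ∈ s then 1 else Fintype.card (M i) := by
  classical
  have : (Finset.univ.filter fun ω' => π ω' = π ω) =
      Fintype.piFinset fun i => if i ∈ s then {ω i} else Finset.univ := by
    ext ω'
    simp only [Finset.mem_filter, Finset.mem_univ, true_and, Fintype.mem_piFinset, hπ]
    refine forall_congr' fun i => ?_
    by_cases hi : i ∈ s <;> simp [hi]
  rw [fiberCard]
  convert congrArg Finset.card this using 1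
  rw [Fintype.card_piFinset]
  refine Finset.prod_congr rfl fun i _ => ?_
  by_cases hi : i ∈ s <;> simp [hi]

variable [∀ i, Nonempty (M i)]

/-- Functions of disjoint sets of coordinates are independent. -/
lemma entropy_add_le_prod_of_disjoint (s : Finset ι) (f : (∀ i, M i) → α) (g : (∀ i, M i) → β)
    (hf : ∀ ω ω', (∀ i ∈ s, ω i = ω' i) → f ω = f ω')
    (hg : ∀ ω ω', (∀ i ∉ s, ω i = ω' i) → g ω = g ω') :
    entropy f + entropy g ≤ entropy (fun ω => (f ω, g ω)) := by
  refine entropy_add_le_prod f g (fun a b i => if i ∈ s then a i else b i)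
    (fun a b => hf _ _ fun i hi => if_pos hi) (fun a b => hg _ _ fun i hi => if_neg hi) ?_
  rintro ⟨a, b⟩ ⟨a', b'⟩ h
  simp only [Prod.mk.injEq, funext_iff] at h ⊢
  refine ⟨fun i => ?_, fun i => ?_⟩ <;>
  · have h1 := h.1 i
    have h2 := h.2 i
    by_cases hi : i ∈ s
    · simp only [if_pos hi] at h1 h2
      assumption
    · simp only [if_neg hi] at h1 h2
      assumption

lemma entropy_partialSum_add_le (X : ∀ i, M i → G) (s u v : Finset ι) (hsu : Disjoint s u)
    (hsv : Disjoint s v) (huv : Disjoint u v) :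
    entropy (partialSum X s) + entropy (partialSum X u) + entropy (partialSum X v) ≤
      entropy (fun ω => (partialSum X s ω, partialSum X u ω, partialSum X v ω)) := by
  have h1 := entropy_add_le_prod_of_disjoint s (partialSum X s)
    (fun ω => (partialSum X u ω, partialSum X v ω)) (partialSum_congr X s) fun ω ω' h =>
      Prod.ext (partialSum_congr X u _ _ fun i hi => h i (Finset.disjoint_right.1 hsu hi))
        (partialSum_congr X v _ _ fun i hi => h i (Finset.disjoint_right.1 hsv hi))
  have h2 := entropy_add_le_prod_of_disjoint u (partialSum X u) (partialSum X v)
    (partialSum_congr X u) fun ω ω' h =>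
      partialSum_congr X v _ _ fun i hi => h i (Finset.disjoint_right.1 huv hi)
  linarith

lemma entropy_partialSum_union_le (X : ∀ i, M i → G) (s u : Finset ι) (hsu : Disjoint s u) :
    entropy (partialSum X (s ∪ u)) ≤ entropy (partialSum X s) + entropy (partialSum X u) := by
  refine le_trans (entropy_mono _ _ fun ω ω' h => ?_)
    (entropy_prod_le (partialSum X s) (partialSum X u))
  simp only [Prod.mk.injEq] at h
  simp only [partialSum_union X s u hsu, Pi.add_apply, h.1, h.2]

lemma entropy_partialSum_mono (X : ∀ i, M i → G) {s u : Finset ι} (hsu : s ⊆ u) :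
    entropy (partialSum X s) ≤ entropy (partialSum X u) := by
  have hd : Disjoint s (u \ s) := Finset.disjoint_sdiff
  have h1 := entropy_add_le_prod_of_disjoint s (partialSum X s) (partialSum X (u \ s))
    (partialSum_congr X s) fun ω ω' h =>
      partialSum_congr X _ _ _ fun i hi => h i (Finset.mem_sdiff.1 hi).2
  have h2 := entropy_prod_le (partialSum X u) (partialSum X (u \ s))
  have h3 := entropy_mono (fun ω => (partialSum X s ω, partialSum X (u \ s) ω))
    (fun ω => (partialSum X u ω, partialSum X (u \ s) ω)) fun ω ω' h => by
      have hu : partialSum X u = partialSum X s + partialSum X (u \ s) := by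
        rw [← partialSum_union X _ _ hd, Finset.union_sdiff_of_subset hsu]
      simp only [Prod.mk.injEq, hu, Pi.add_apply] at h ⊢
      refine ⟨?_, h.2⟩
      rw [h.2] at h
      exact add_right_cancel h.1
  linarith

/-- More interference (the users in `v`) only reduces the information about the users in `s`. -/
lemma entropy_partialSum_submodular (X : ∀ i, M i → G) (s u v : Finset ι) (hsu : Disjoint s u)
    (hsv : Disjoint s v) (huv : Disjoint u v) :
    entropy (partialSum X (s ∪ u ∪ v)) + entropy (partialSum X u) ≤
      entropy (partialSum X (s ∪ u)) + entropy (partialSum X (u ∪ v)) := by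
  have h := entropy_add_add_le (partialSum X s) (partialSum X v) (partialSum X u)
    (entropy_partialSum_add_le X s v u hsv hsu huv.symm)
  rwa [← partialSum_union X s u hsu, ← partialSum_union X v u huv.symm,
    ← partialSum_union X s v hsv, ← partialSum_union X (s ∪ v) u
      (Finset.disjoint_union_left.2 ⟨hsu, huv.symm⟩), Finset.union_right_comm,
    Finset.union_comm v u] at h

lemma entropy_comp_eval (i : ι) (F : M i → α) :
    entropy (fun ω : ∀ i, M i => F (ω i)) = entropy F :=
  entropy_comp (fun ω : ∀ i, M i => ω i) (Function.surjective_eval i) _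
    (fiberCard_restrict {i} _ fun ω ω' => by simp) F

lemma entropy_comp_eval_pair {i k : ι} (hik : i ≠ k) (F : M i × M k → α) :
    entropy (fun ω : ∀ i, M i => F (ω i, ω k)) = entropy F := by
  refine entropy_comp (fun ω : ∀ i, M i => (ω i, ω k)) ?_ _
    (fiberCard_restrict {i, k} _ fun ω ω' => by simp) F
  rintro ⟨a, b⟩
  refine ⟨Function.update (Function.update (fun _ => Classical.arbitrary _) i a) k b, ?_⟩
  simp [Function.update_of_ne hik]

lemma entropy_partialSum_singleton (X : ∀ i, M i → G) (i : ι) :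
    entropy (partialSum X {i}) = entropy (X i) := by
  rw [← entropy_comp_eval i (X i)]
  congr 1
  funext ω
  simp [partialSum]

end Users

section UsersPair

variable {ι : Type*} [Fintype ι] [DecidableEq ι] {M : ι → Type} [∀ i, Fintype (M i)]
  [∀ i, Nonempty (M i)] {G : Type*} [AddCommGroup G]

lemma entropy_partialSum_pair (X : ∀ i, M i → G) {i k : ι} (hik : i ≠ k) :
    entropy (partialSum X {i, k}) = entropy (indepSum (X i) (X k)) := by
  rw [← entropy_comp_eval_pair hik (indepSum (X i) (X k))]
  congr 1
  funext ω
  simp [partialSum, indepSum, Finset.sum_pair hik]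

end UsersPair

/-! ### Coding schemes -/

namespace CodingScheme

variable {K n : ℕ} {R P : Fin K → ℝ}

/-- The codewords of user `i`, rounded down to integer vectors. -/
noncomputable def quantized (S : CodingScheme n R P) (i : Fin K) : Message n R i → Fin n → ℤ :=
  fun w t => ⌊S.encode i w t⌋

/-- The deterministic integer output with gains `c`, restricted to the users in `s`. -/
noncomputable def output (S : CodingScheme n R P) (c : Fin K → ℤ) (s : Finset (Fin K)) :
    ((i : Fin K) → Message n R i) → Fin n → ℤ :=
  partialSum (fun i => c i • S.quantized i) s

lemma messageLaw_singleton (ω : (i : Fin K) → Message n R i) :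
    messageLaw n R {ω} = (Fintype.card ((i : Fin K) → Message n R i) : ℝ≥0∞)⁻¹ := by
  rw [messageLaw, Measure.pi_singleton]
  simp only [uniformOn_univ, Measure.count_singleton, one_div, Fintype.card_pi]
  push_cast
  exact (ENNReal.prod_inv_distrib fun i _ j _ _ => Or.inr (ENNReal.natCast_ne_top _)).symm

/-- The error probability as the average, over all messages, of a Gaussian measure. -/
lemma errorProb_eq_sum (S : CodingScheme n R P) (H : Matrix (Fin K) (Fin K) ℝ) (j : Fin K) :
    S.errorProb H (fun _ => 1) j =
      ∑ ω : (i : Fin K) → Message n R i, (Measure.pi fun _ : Fin n => gaussianReal 0 1)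
        {z | S.decode j (fun t => z t + ∑ i, S.encode i (ω i) t * H i j) = ω j}ᶜ *
        (Fintype.card ((i : Fin K) → Message n R i) : ℝ≥0∞)⁻¹ := by
  have hdec := S.measurable_decode j
  have henc : ∀ i, Measurable (S.encode i) := fun i => measurable_of_finite _
  have hmeas : MeasurableSet {p : ((i : Fin K) → Message n R i) × (Fin K → Fin n → ℝ) |
      S.decode j (received H (fun i => S.encode i (p.1 i)) p.2 j) ≠ p.1 j} := by
    refine (measurableSet_eq_fun (hdec.comp ?_) (by fun_prop)).compl
    refine measurable_pi_lambda _ fun t => ?_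
    simp only [received]
    refine Measurable.add (by fun_prop) (Finset.measurable_sum _ fun i _ => ?_)
    exact ((measurable_pi_apply t).comp ((henc i).comp (by fun_prop))).mul_const _
  have : SFinite (noiseLaw n fun _ : Fin K => (1 : ℝ≥0)) := by
    unfold noiseLaw
    infer_instance
  rw [errorProb, Measure.prod_apply hmeas, lintegral_fintype]
  refine Finset.sum_congr rfl fun ω _ => ?_
  rw [messageLaw_singleton]
  congr 1
  have hset : MeasurableSet
      {z : Fin n → ℝ | S.decode j (fun t => z t + ∑ i, S.encode i (ω i) t * H i j) = ω j}ᶜ := by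
    refine (measurableSet_eq_fun (hdec.comp ?_) measurable_const).compl
    fun_prop
  have hmp := measurePreserving_eval
    (fun _ : Fin K => Measure.pi fun _ : Fin n => gaussianReal 0 1) j
  exact hmp.measure_preimage hset.nullMeasurableSet

/-- The receiver learns almost as much from the integer output as from the noisy channel output:
given the integer output, the message has little entropy left. -/
lemma entropy_message_sub_le (S : CodingScheme n R P) (H : Matrix (Fin K) (Fin K) ℝ) (D : ℕ)
    (hD : 0 < D) (a : Fin K → Fin K → ℤ) (ha : ∀ i j, (a i j : ℝ) = D * H i j) (r : ℝ) (j : Fin K)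
    (hr : ∑ i, |H i j| ≤ r) (hfin : S.errorProb H (fun _ => 1) j ≠ ⊤) :
    entropy (fun ω : (i : Fin K) → Message n R i =>
        (ω j, S.output (fun i => a i j) Finset.univ ω)) -
        entropy (S.output (fun i => a i j) Finset.univ) ≤
      Real.log (2 * (2 * shiftLoss r ^ n)) + 2 * (S.errorProb H (fun _ => 1) j).toReal *
        Real.log (2 * Fintype.card (Message n R j)) := by
  classical
  set s : ((i : Fin K) → Message n R i) → Fin n → ℝ :=
    fun ω t => ∑ i, S.encode i (ω i) t * H i j with hs
  set γ : Measure (Fin n → ℝ) := Measure.pi fun _ : Fin n => gaussianReal 0 1 with hγ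
  set G : Finset ((i : Fin K) → Message n R i) := Finset.univ.filter fun ω =>
    1 / 2 ≤ γ {z | S.decode j (fun t => z t + s ω t) = ω j} with hG
  refine entropy_prod_sub_le (S.output (fun i => a i j) Finset.univ) (fun ω => ω j) G
    (2 * shiftLoss r ^ n) _ ?_ ?_ fun v => ?_
  · have := one_le_pow₀ (one_le_shiftLoss r) (n := n)
    linarith
  · have hcard := cast_card_pos (Ω := (i : Fin K) → Message n R i)
    have h1 : ((Gᶜ).card : ℝ≥0∞) *
        (1 / 2 * (Fintype.card ((i : Fin K) → Message n R i) : ℝ≥0∞)⁻¹) ≤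
        S.errorProb H (fun _ => 1) j := by
      rw [errorProb_eq_sum, ← nsmul_eq_mul]
      refine (Finset.card_nsmul_le_sum Gᶜ _ _ fun ω hω => ?_).trans
        (Finset.sum_le_sum_of_subset (Finset.subset_univ _))
      refine mul_le_mul_left ?_ _
      have hω : γ {z | S.decode j (fun t => z t + s ω t) = ω j} < 1 / 2 := by
        simpa [hG] using hω
      by_contra hcon
      have h2 : (1 : ℝ≥0∞) ≤ γ {z | S.decode j (fun t => z t + s ω t) = ω j} +
          γ {z | S.decode j (fun t => z t + s ω t) = ω j}ᶜ := by
        rw [← measure_univ (μ := γ), ← Set.union_compl_self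
          {z | S.decode j (fun t => z t + s ω t) = ω j}]
        exact measure_union_le _ _
      have h3 := ENNReal.add_lt_add hω (not_le.1 hcon)
      rw [ENNReal.add_halves] at h3
      exact absurd h2 (not_le.2 h3)
    have h2 := ENNReal.toReal_mono hfin h1
    simp only [ENNReal.toReal_mul, ENNReal.toReal_natCast, one_div, ENNReal.toReal_inv,
      ENNReal.toReal_ofNat] at h2
    have h3 := mul_le_mul_of_nonneg_right h2
      (by positivity : (0 : ℝ) ≤ 2 * Fintype.card ((i : Fin K) → Message n R i))
    have h4 : ((Gᶜ).card : ℝ) = (Gᶜ).card *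
        (2⁻¹ * (Fintype.card ((i : Fin K) → Message n R i) : ℝ)⁻¹) *
        (2 * Fintype.card ((i : Fin K) → Message n R i)) := by
      rw [mul_assoc, mul_mul_mul_comm, inv_mul_cancel₀ two_ne_zero, inv_mul_cancel₀ hcard.ne',
        one_mul, mul_one]
    have h5 : (G.card : ℝ) + (Gᶜ).card = Fintype.card ((i : Fin K) → Message n R i) := by
      exact_mod_cast Finset.card_add_card_compl G
    linarith
  · refine card_image_le_of_decoded (S.decode j) (S.measurable_decode j) _ s _
      (fun t => v t / D) r (fun ω hω t => ?_) fun ω hω => ?_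
    · have hv : S.output (fun i => a i j) Finset.univ ω = v := (Finset.mem_filter.1 hω).2
      have hD0 : (D : ℝ) ≠ 0 := by exact_mod_cast hD.ne'
      have hvt : (v t : ℝ) / D = ∑ i, (⌊S.encode i (ω i) t⌋ : ℝ) * H i j := by
        rw [← hv]
        simp only [output, partialSum, quantized, Finset.sum_apply, Pi.smul_apply, smul_eq_mul]
        push_cast
        rw [Finset.sum_div]
        refine Finset.sum_congr rfl fun i _ => ?_
        rw [ha]
        field_simp
      rw [hvt, hs, ← Finset.sum_sub_distrib]
      refine (Finset.abs_sum_le_sum_abs _ _).trans ((Finset.sum_le_sum fun i _ => ?_).trans hr)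
      rw [← sub_mul, abs_mul]
      refine mul_le_of_le_one_left (abs_nonneg _) ?_
      rw [Int.self_sub_floor, abs_of_nonneg (Int.fract_nonneg _)]
      exact (Int.fract_lt_one _).le
    · exact (Finset.mem_filter.1 (Finset.mem_filter.1 hω).1).2

/-- The integer output satisfies a power constraint, hence has entropy about `n / 2 * log p`. -/
lemma entropy_output_le {p : ℝ} (S : CodingScheme n R fun _ => p) (hp : 1 ≤ p) (c : Fin K → ℤ)
    (A : ℝ) (hA : 1 ≤ A) (hc : ∑ i, |(c i : ℝ)| ≤ A) :
    entropy (S.output c Finset.univ) ≤ n * (1 / 2 * Real.log p + Real.log (8 * Real.exp 1 * A)) := by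
  classical
  have hsq : 1 ≤ √p := Real.one_le_sqrt.2 hp
  have hB : 1 ≤ 2 * A * √p := by nlinarith
  have hx : ∀ i w, ∑ t, |S.encode i w t| ≤ n * √p := by
    intro i w
    have h1 := sq_sum_le_card_mul_sum_sq (s := Finset.univ) (f := fun t => |S.encode i w t|)
    simp only [sq_abs, Finset.card_univ, Fintype.card_fin] at h1
    have h2 := S.power_le i w
    have h3 : (∑ t, |S.encode i w t|) ^ 2 ≤ (n * √p) ^ 2 := by
      rw [mul_pow, Real.sq_sqrt (by linarith)]
      have : (n : ℝ) * ∑ t, S.encode i w t ^ 2 ≤ n * (n * p) :=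
        mul_le_mul_of_nonneg_left h2 (Nat.cast_nonneg _)
      linarith
    exact (le_abs_self _).trans (abs_le_of_sq_le_sq h3 (by positivity))
  have hV : ∀ ω, ∑ t, |(S.output c Finset.univ ω t : ℝ)| ≤ n * (2 * A * √p) := by
    intro ω
    have h1 : ∀ t, |(S.output c Finset.univ ω t : ℝ)| ≤
        ∑ i, |(c i : ℝ)| * (|S.encode i (ω i) t| + 1) := by
      intro t
      simp only [output, partialSum, quantized, Finset.sum_apply, Pi.smul_apply, smul_eq_mul]
      push_cast
      refine (Finset.abs_sum_le_sum_abs _ _).trans (Finset.sum_le_sum fun i _ => ?_)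
      rw [abs_mul]
      refine mul_le_mul_of_nonneg_left ?_ (abs_nonneg _)
      have h3 := Int.floor_le (S.encode i (ω i) t)
      have h4 := Int.lt_floor_add_one (S.encode i (ω i) t)
      rw [abs_le]
      constructor <;> linarith [neg_abs_le (S.encode i (ω i) t), le_abs_self (S.encode i (ω i) t)]
    calc _ ≤ ∑ t, ∑ i, |(c i : ℝ)| * (|S.encode i (ω i) t| + 1) := Finset.sum_le_sum fun t _ => h1 t
      _ = ∑ i, |(c i : ℝ)| * (∑ t, |S.encode i (ω i) t| + n) := by
          rw [Finset.sum_comm]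
          refine Finset.sum_congr rfl fun i _ => ?_
          rw [← Finset.mul_sum, Finset.sum_add_distrib]
          simp
      _ ≤ ∑ i, |(c i : ℝ)| * (n * (2 * √p)) := by
          refine Finset.sum_le_sum fun i _ => mul_le_mul_of_nonneg_left ?_ (abs_nonneg _)
          have := hx i (ω i)
          have : (n : ℝ) * 1 ≤ n * √p := mul_le_mul_of_nonneg_left hsq (Nat.cast_nonneg _)
          linarith
      _ ≤ n * (2 * A * √p) := by
          rw [← Finset.sum_mul]
          have := mul_le_mul_of_nonneg_right hc (by positivity : (0 : ℝ) ≤ n * (2 * √p))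
          linarith
  set T : Finset (Fin n → ℤ) := Finset.univ.image (S.output c Finset.univ) with hT
  have hmem : ∀ ω, S.output c Finset.univ ω ∈ T := fun ω =>
    Finset.mem_image_of_mem _ (Finset.mem_univ ω)
  refine (entropy_le_log_card _ T hmem).trans ?_
  have hcard := card_le_of_sum_abs_le hB T fun v hv => by
    obtain ⟨ω, -, rfl⟩ := Finset.mem_image.1 hv
    exact hV ω
  have hTpos : (0 : ℝ) < T.card := by
    exact_mod_cast Finset.card_pos.2 ⟨_, hmem (Classical.arbitrary _)⟩
  refine (Real.log_le_log hTpos hcard).trans (le_of_eq ?_)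
  rw [Real.log_pow, show Real.exp 1 * (4 * (2 * A * √p)) = √p * (8 * Real.exp 1 * A) by ring,
    Real.log_mul (by positivity) (by positivity), Real.log_sqrt (by linarith)]
  ring

end CodingScheme

/-! ### Rate bounds -/

namespace CodingScheme

variable {K n : ℕ} {R P : Fin K → ℝ}

lemma entropy_output_singleton (S : CodingScheme n R P) {c : Fin K → ℤ} (i : Fin K)
    (hc : c i ≠ 0) : entropy (S.output c {i}) = entropy (S.quantized i) := by
  rw [output, entropy_partialSum_singleton, entropy_zsmul _ hc]

/-- A receiver that decodes its message `j` sees the entropy of that message on top of the entropy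
of the interference. -/
lemma log_card_add_entropy_interference_le (S : CodingScheme n R P) (c : Fin K → ℤ) (j : Fin K)
    {E : ℝ} (hE : entropy (fun ω : (i : Fin K) → Message n R i => (ω j, S.output c Finset.univ ω)) -
      entropy (S.output c Finset.univ) ≤ E) :
    Real.log (Fintype.card (Message n R j)) + entropy (S.output c (Finset.univ.erase j)) ≤
      entropy (S.output c Finset.univ) + E := by
  have h1 := entropy_add_le_prod_of_disjoint {j} (fun ω : (i : Fin K) → Message n R i => ω j)
    (S.output c (Finset.univ.erase j)) (fun ω ω' h => h j (Finset.mem_singleton_self j))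
    fun ω ω' h => partialSum_congr _ _ _ _ fun i hi => h i (by simpa using hi)
  have h2 : entropy (fun ω : (i : Fin K) → Message n R i => ω j) =
      Real.log (Fintype.card (Message n R j)) :=
    (entropy_comp_eval j fun w : Message n R j => w).trans entropy_id
  have h3 := entropy_mono (fun ω : (i : Fin K) → Message n R i =>
    (ω j, S.output c (Finset.univ.erase j) ω)) (fun ω => (ω j, S.output c Finset.univ ω))
    fun ω ω' h => by
      simp only [Prod.mk.injEq, output, partialSum] at h ⊢
      refine ⟨h.1, ?_⟩
      have h4 := h.2
      rw [← Finset.add_sum_erase _ _ (Finset.mem_univ j),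
        ← Finset.add_sum_erase _ _ (Finset.mem_univ j), h.1] at h4
      exact add_left_cancel h4
  linarith

variable (S : CodingScheme n R P) {a : Fin K → Fin K → ℤ} {L E : ℝ}

lemma log_card_le_entropy_quantized (ha : ∀ i j, a i j ≠ 0)
    (hE : ∀ j, entropy (fun ω : (i : Fin K) → Message n R i =>
      (ω j, S.output (fun i => a i j) Finset.univ ω)) -
      entropy (S.output (fun i => a i j) Finset.univ) ≤ E) (j : Fin K) :
    Real.log (Fintype.card (Message n R j)) ≤ entropy (S.quantized j) + E := by
  have h1 := S.log_card_add_entropy_interference_le (fun i => a i j) j (hE j)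
  have h2 := entropy_partialSum_union_le (fun i => a i j • S.quantized i) {j}
    (Finset.univ.erase j) (by simp)
  rw [← Finset.insert_eq, Finset.insert_erase (Finset.mem_univ j)] at h2
  have h3 := S.entropy_output_singleton (c := fun i => a i j) j (ha j j)
  simp only [output] at h1 h3 ⊢
  linarith

/-- Two users together have at most one degree of freedom. -/
lemma log_card_add_log_card_le (ha : ∀ i j, a i j ≠ 0)
    (hE : ∀ j, entropy (fun ω : (i : Fin K) → Message n R i =>
      (ω j, S.output (fun i => a i j) Finset.univ ω)) -
      entropy (S.output (fun i => a i j) Finset.univ) ≤ E)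
    (hL : ∀ j, entropy (S.output (fun i => a i j) Finset.univ) ≤ L + E) {i j : Fin K}
    (hij : i ≠ j) :
    Real.log (Fintype.card (Message n R i)) + Real.log (Fintype.card (Message n R j)) ≤
      L + 3 * E := by
  have h1 := S.log_card_add_entropy_interference_le (fun i => a i j) j (hE j)
  have h2 := S.log_card_le_entropy_quantized ha hE i
  have h3 := entropy_partialSum_mono (fun i => a i j • S.quantized i)
    (s := {i}) (u := Finset.univ.erase j) (by simpa using hij)
  have h4 := S.entropy_output_singleton (c := fun i => a i j) i (ha i j)
  have h5 := hL j
  simp only [output] at h1 h3 h4 h5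
  linarith

/-- The conflict between three users. At receiver `l` the users `i` and `k` are interferers, so
their sum there has small entropy if the rates nearly fill the pairwise bounds; then so has every
integer combination of their signals, although receiver `i` has to tell them apart. -/
lemma log_card_le_deficit (ha : ∀ i j, a i j ≠ 0)
    (hE : ∀ j, entropy (fun ω : (i : Fin K) → Message n R i =>
      (ω j, S.output (fun i => a i j) Finset.univ ω)) -
      entropy (S.output (fun i => a i j) Finset.univ) ≤ E)
    (hL : ∀ j, entropy (S.output (fun i => a i j) Finset.univ) ≤ L + E) {i k l : Fin K}
    (hik : i ≠ k) (hil : i ≠ l) (hkl : k ≠ l) :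
    Real.log (Fintype.card (Message n R i)) ≤ E +
      3 * ((a k l * a i i).natAbs + (a i l * a k i).natAbs : ℝ) *
        (2 * (L + 3 * E) - 2 * Real.log (Fintype.card (Message n R l)) -
          Real.log (Fintype.card (Message n R i)) - Real.log (Fintype.card (Message n R k))) := by
  have hi := S.log_card_le_entropy_quantized ha hE i
  have hk := S.log_card_le_entropy_quantized ha hE k
  -- Receiver `l`: the interference of users `i` and `k` is nearly aligned.
  have h1 := S.log_card_add_entropy_interference_le (fun i => a i l) l (hE l)
  have h2 : entropy (S.output (fun i => a i l) {i, k}) ≤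
      entropy (S.output (fun i => a i l) (Finset.univ.erase l)) :=
    entropy_partialSum_mono (fun i => a i l • S.quantized i) (by
      intro m hm
      rcases Finset.mem_insert.1 hm with rfl | hm
      · simpa using hil
      · rw [Finset.mem_singleton.1 hm]
        simpa using hkl)
  have h3 : entropy (S.output (fun i => a i l) {i, k}) =
      entropy (indepSum (a i l • S.quantized i) (a k l • S.quantized k)) :=
    entropy_partialSum_pair (fun i => a i l • S.quantized i) hik
  have h4 := hL l
  -- Receiver `i`: the signals of users `i` and `k` must be distinguishable.
  have h5 := S.log_card_add_entropy_interference_le (fun k => a k i) i (hE i)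
  have h6 := entropy_partialSum_submodular (fun k => a k i • S.quantized k) {i} {k}
    ((Finset.univ.erase i).erase k) (by simpa using hik) (by simp) (by simp)
  have e1 : ({k} ∪ (Finset.univ.erase i).erase k : Finset (Fin K)) = Finset.univ.erase i := by
    rw [← Finset.insert_eq, Finset.insert_erase (by simpa using hik.symm)]
  have e2 : ({i} ∪ {k} ∪ (Finset.univ.erase i).erase k : Finset (Fin K)) = Finset.univ := by
    rw [Finset.union_assoc, e1, ← Finset.insert_eq, Finset.insert_erase (Finset.mem_univ i)]
  rw [e1, e2, show ({i} ∪ {k} : Finset (Fin K)) = {i, k} from rfl,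
    entropy_partialSum_pair _ hik] at h6
  have h7 := S.entropy_output_singleton (c := fun k' => a k' i) k (ha k i)
  have h8 := entropy_combination_le (S.quantized i) (S.quantized k) (ha i l) (ha k l)
    (a i i) (a k i)
  simp only [output] at h1 h2 h3 h4 h5 h7
  set N : ℝ := ((a k l * a i i).natAbs + (a i l * a k i).natAbs : ℝ) with hN
  have hN0 : 0 ≤ N := by positivity
  have h9 : N * (3 * (2 * entropy (indepSum (a i l • S.quantized i) (a k l • S.quantized k)) -
      entropy (S.quantized i) - entropy (S.quantized k))) ≤
      N * (3 * (2 * (L + 3 * E) - 2 * Real.log (Fintype.card (Message n R l)) -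
          Real.log (Fintype.card (Message n R i)) - Real.log (Fintype.card (Message n R k)))) := by
    refine mul_le_mul_of_nonneg_left ?_ hN0
    linarith
  linarith

end CodingScheme

/-- If all pairs satisfy `ρ i + ρ j ≤ B` while the sum of all `ρ i` is almost `K / 2 * B`, then no
pair can fall far short of `B`. -/
lemma pair_deficit_le {K : ℕ} (ρ : Fin K → ℝ) (B : ℝ) (h : ∀ i j, i ≠ j → ρ i + ρ j ≤ B)
    {i j : Fin K} (hij : i ≠ j) :
    B - ρ i - ρ j ≤ (K - 1) * (K * B - 2 * ∑ m, ρ m) := by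
  have h0 : ∀ l m, 0 ≤ if l = m then 0 else B - ρ l - ρ m := fun l m => by
    split_ifs with hlm
    · exact le_rfl
    · linarith [h l m hlm]
  have h1 : B - ρ i - ρ j ≤ ∑ l, ∑ m, if l = m then 0 else B - ρ l - ρ m := by
    refine le_trans ?_ (Finset.single_le_sum (f := fun l => ∑ m, if l = m then 0 else B - ρ l - ρ m)
      (fun l _ => Finset.sum_nonneg fun m _ => h0 l m) (Finset.mem_univ i))
    refine le_trans ?_ (Finset.single_le_sum (f := fun m => if i = m then 0 else B - ρ i - ρ m)
      (fun m _ => h0 i m) (Finset.mem_univ j))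
    simp [hij]
  refine h1.trans (le_of_eq ?_)
  have h2 : ∀ l, (∑ m, if l = m then 0 else B - ρ l - ρ m) =
      K * B - K * ρ l - (∑ m, ρ m) - (B - 2 * ρ l) := by
    intro l
    have h3 : ∀ m, (if l = m then 0 else B - ρ l - ρ m) =
        (B - ρ l - ρ m) - if l = m then B - ρ l - ρ m else 0 := fun m => by
      split_ifs <;> ring
    simp only [h3, Finset.sum_sub_distrib, Finset.sum_ite_eq, Finset.mem_univ, if_true,
      Finset.sum_const, Finset.card_univ, Fintype.card_fin, nsmul_eq_mul]
    ring
  simp only [h2, Finset.sum_sub_distrib, Finset.sum_const, Finset.card_univ, Fintype.card_fin,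
    nsmul_eq_mul, ← Finset.mul_sum]
  ring

/-- A common denominator of the gains. -/
lemma exists_common_denominator {K : ℕ} (H : Matrix (Fin K) (Fin K) ℝ)
    (hrat : ∀ i j, ∃ q : ℚ, H i j = (q : ℝ)) :
    ∃ (D : ℕ) (a : Fin K → Fin K → ℤ), 0 < D ∧ ∀ i j, (a i j : ℝ) = D * H i j := by
  choose q hq using hrat
  set D : ℕ := ∏ i, ∏ j, (q i j).den with hD
  have hdvd : ∀ i j, (q i j).den ∣ D := fun i j =>
    (Finset.dvd_prod_of_mem _ (Finset.mem_univ j)).trans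
      (Finset.dvd_prod_of_mem (fun i => ∏ j, (q i j).den) (Finset.mem_univ i))
  choose e he using hdvd
  refine ⟨D, fun i j => e i j * (q i j).num,
    Finset.prod_pos fun i _ => Finset.prod_pos fun j _ => (q i j).den_pos, fun i j => ?_⟩
  rw [hq, he i j]
  push_cast
  have h1 : ((q i j : ℚ) : ℝ) = (q i j).num / (q i j).den := by
    exact_mod_cast congrArg (Rat.cast (K := ℝ)) (Rat.num_div_den (q i j)).symm
  have h2 : ((q i j).den : ℝ) ≠ 0 := by exact_mod_cast (q i j).den_nz
  rw [h1]
  field_simp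

lemma mul_log_two_le_log_card {K n : ℕ} (R : Fin K → ℝ) (i : Fin K) :
    n * R i * Real.log 2 ≤ Real.log (Fintype.card (Message n R i)) := by
  rw [Fintype.card_fin]
  push_cast
  rw [Real.log_pow]
  exact mul_le_mul_of_nonneg_right (Nat.le_ceil _) (Real.log_nonneg one_le_two)

lemma log_two_mul_card_le {K n : ℕ} (hn : 1 ≤ n) (R : Fin K → ℝ) (i : Fin K) (hR : 0 ≤ R i) :
    Real.log (2 * Fintype.card (Message n R i)) ≤ n * (R i + 2) := by
  rw [Fintype.card_fin]
  push_cast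
  rw [← pow_succ', Real.log_pow]
  have h1 := Nat.ceil_lt_add_one (by positivity : (0 : ℝ) ≤ n * R i)
  have h2 := Real.log_two_lt_d9
  have h3 : (1 : ℝ) ≤ n := by exact_mod_cast hn
  have h4 : 0 ≤ Real.log 2 := Real.log_nonneg one_le_two
  have h5 : ((⌈(n : ℝ) * R i⌉₊ : ℝ) + 1) * Real.log 2 ≤ (n * R i + 2) * 1 :=
    mul_le_mul (by linarith) (by linarith) h4 (by positivity)
  push_cast
  nlinarith

/-- At large block lengths, both losses in the rate bounds (from the noise and from the decoding
errors) are linear in the block length, with a constant that depends neither on the power nor on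
the rates. -/
lemma exists_scheme {K : ℕ} (H : Matrix (Fin K) (Fin K) ℝ) (D : ℕ) (hD : 0 < D)
    (a : Fin K → Fin K → ℤ) (ha : ∀ i j, (a i j : ℝ) = D * H i j) :
    ∃ κ : ℝ, 0 ≤ κ ∧ ∀ p : ℝ, 1 ≤ p → ∀ R ∈ capacityRegion H (fun _ => 1) (fun _ => p),
      ∃ n : ℕ, 1 ≤ n ∧ ∃ S : CodingScheme n R fun _ => p,
        (∀ j, entropy (fun ω : (i : Fin K) → Message n R i =>
          (ω j, S.output (fun i => a i j) Finset.univ ω)) -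
          entropy (S.output (fun i => a i j) Finset.univ) ≤ n * κ) ∧
        ∀ j, entropy (S.output (fun i => a i j) Finset.univ) ≤
          n * (1 / 2 * Real.log p) + n * κ := by
  set r : ℝ := ∑ j, ∑ i, |H i j| with hr
  set A : ℝ := 1 + ∑ j, ∑ i, |(a i j : ℝ)| with hA
  have hA1 : 1 ≤ A := by
    have : 0 ≤ ∑ j, ∑ i, |(a i j : ℝ)| :=
      Finset.sum_nonneg fun _ _ => Finset.sum_nonneg fun _ _ => abs_nonneg _
    linarith
  have hexp : 1 ≤ Real.exp 1 := Real.one_le_exp zero_le_one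
  have hκ1 : 0 ≤ Real.log (8 * Real.exp 1 * A) := Real.log_nonneg (by nlinarith)
  have hκ2 : 0 ≤ Real.log (shiftLoss r) := Real.log_nonneg (one_le_shiftLoss r)
  refine ⟨Real.log (shiftLoss r) + 3 + Real.log (8 * Real.exp 1 * A), by linarith,
    fun p hp R hR => ?_⟩
  obtain ⟨hR0, S, hS⟩ := hR
  have hδ : ∀ᶠ n in atTop, ∀ j, 2 * ((S n).errorProb H (fun _ => 1) j).toReal * (R j + 2) ≤ 1 ∧
      (S n).errorProb H (fun _ => 1) j ≠ ⊤ := by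
    refine eventually_all.2 fun j => ?_
    have h1 : Tendsto (fun n => (S n).errorProb H (fun _ => 1) j) atTop (𝓝 0) :=
      tendsto_of_tendsto_of_tendsto_of_le_of_le tendsto_const_nhds hS (fun _ => zero_le)
        fun n => le_iSup (fun j => (S n).errorProb H (fun _ => 1) j) j
    have h2 : Tendsto (fun n => 2 * ((S n).errorProb H (fun _ => 1) j).toReal * (R j + 2)) atTop
        (𝓝 (2 * (0 : ℝ≥0∞).toReal * (R j + 2))) :=
      (((ENNReal.tendsto_toReal ENNReal.zero_ne_top).comp h1).const_mul 2).mul_const _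
    simp only [ENNReal.toReal_zero, mul_zero, zero_mul] at h2
    filter_upwards [h2.eventually_lt_const one_pos, h1.eventually_lt_const ENNReal.zero_lt_top]
      with n h3 h4
    exact ⟨h3.le, h4.ne⟩
  obtain ⟨n, hn, hn1⟩ := (hδ.and (eventually_ge_atTop 1)).exists
  have hn1' : (1 : ℝ) ≤ n := by exact_mod_cast hn1
  refine ⟨n, hn1, S n, fun j => ?_, fun j => ?_⟩
  · refine ((S n).entropy_message_sub_le H D hD a ha r j ?_ (hn j).2).trans ?_
    · exact Finset.single_le_sum (f := fun j => ∑ i, |H i j|)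
        (fun _ _ => Finset.sum_nonneg fun _ _ => abs_nonneg _) (Finset.mem_univ j)
    · have h1 := log_two_mul_card_le hn1 R j (hR0 j)
      have hC : 0 < shiftLoss r := zero_lt_one.trans_le (one_le_shiftLoss r)
      have h2 : Real.log (2 * (2 * shiftLoss r ^ n)) =
          2 * Real.log 2 + n * Real.log (shiftLoss r) := by
        rw [Real.log_mul two_ne_zero (by positivity), Real.log_mul two_ne_zero (by positivity),
          Real.log_pow]
        ring
      have h3 : 2 * ((S n).errorProb H (fun _ => 1) j).toReal *
          Real.log (2 * Fintype.card (Message n R j)) ≤ n * 1 := by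
        calc _ ≤ 2 * ((S n).errorProb H (fun _ => 1) j).toReal * (n * (R j + 2)) :=
              mul_le_mul_of_nonneg_left h1 (by positivity)
          _ = n * (2 * ((S n).errorProb H (fun _ => 1) j).toReal * (R j + 2)) := by ring
          _ ≤ n * 1 := mul_le_mul_of_nonneg_left (hn j).1 (Nat.cast_nonneg _)
      have h4 := Real.log_two_lt_d9
      have h5 : 0 ≤ n * Real.log (8 * Real.exp 1 * A) := mul_nonneg (Nat.cast_nonneg _) hκ1
      rw [h2]
      linarith
  · refine ((S n).entropy_output_le hp (fun i => a i j) A hA1 ?_).trans ?_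
    · have : ∑ i, |(a i j : ℝ)| ≤ ∑ j, ∑ i, |(a i j : ℝ)| :=
        Finset.single_le_sum (f := fun j => ∑ i, |(a i j : ℝ)|)
          (fun _ _ => Finset.sum_nonneg fun _ _ => abs_nonneg _) (Finset.mem_univ j)
      linarith
    · have h5 : (0 : ℝ) ≤ n * (Real.log (shiftLoss r) + 3) := by positivity
      linarith

/-- For large powers, the sum rate stays below `K / 2 - ε` times `1 / 2 * log p`, for an `ε` that
depends on the gains only. -/
lemma exists_sum_rate_lt {K : ℕ} (hK : 2 < K) (H : Matrix (Fin K) (Fin K) ℝ)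
    (hfull : FullyConnected H) (hrat : ∀ i j, ∃ q : ℚ, H i j = (q : ℝ)) :
    ∃ ε : ℝ, 0 < ε ∧ ∀ᶠ p : ℝ in atTop,
      ∀ R ∈ capacityRegion H (fun _ => 1) (fun _ => p),
        ∑ i, R i ≤ (K / 2 - ε) * (1 / 2 * Real.logb 2 p) := by
  obtain ⟨D, a, hD, ha⟩ := exists_common_denominator H hrat
  have ha0 : ∀ i j, a i j ≠ 0 := fun i j h => by
    have h1 := ha i j
    rw [h, Int.cast_zero] at h1
    have h2 : (D : ℝ) ≠ 0 := by exact_mod_cast hD.ne'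
    exact mul_ne_zero h2 (hfull i j) h1.symm
  obtain ⟨κ, hκ, hscheme⟩ := exists_scheme H D hD a ha
  set i : Fin K := ⟨0, by omega⟩
  set k : Fin K := ⟨1, by omega⟩
  set l : Fin K := ⟨2, by omega⟩
  have hik : i ≠ k := by simp [i, k]
  have hil : i ≠ l := by simp [i, l]
  have hkl : k ≠ l := by simp [k, l]
  set N : ℝ := ((a k l * a i i).natAbs + (a i l * a k i).natAbs : ℝ) with hN
  have hN0 : 0 ≤ N := by positivity
  have hK' : (2 : ℝ) < K := by exact_mod_cast hK
  -- The three deficits, each at most `3 (K - 1) K E + 2 (K - 1) ε L`, enter with total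
  -- weight `2 + 12 N`; this `ε` makes the `L`-part of their contribution equal to `L / 2`.
  set ε : ℝ := 1 / (4 * (K - 1) * (2 + 12 * N)) with hε
  have hε0 : 0 < ε := by
    have : (0 : ℝ) < K - 1 := by linarith
    positivity
  have hεeq : (2 + 12 * N) * ((K - 1) * (2 * ε)) = 1 / 2 := by
    have h1 : (K - 1 : ℝ) ≠ 0 := by linarith
    have h2 : 2 + 12 * N ≠ 0 := by positivity
    rw [hε]
    field_simp
    norm_num
  refine ⟨ε, hε0, ?_⟩
  set c : ℝ := 2 * ((2 + (2 + 12 * N) * ((K - 1) * (3 * K))) * κ) with hc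
  filter_upwards [eventually_ge_atTop 1,
    Real.tendsto_log_atTop.eventually_gt_atTop (2 * c)] with p hp hlog R hR
  by_contra! hcon
  obtain ⟨n, hn, S, hE, hL⟩ := hscheme p hp R hR
  have hn0 : (0 : ℝ) < n := by exact_mod_cast hn
  set L : ℝ := n * (1 / 2 * Real.log p) with hLdef
  set E : ℝ := n * κ with hEdef
  set ρ : Fin K → ℝ := fun i => Real.log (Fintype.card (Message n R i)) with hρ
  have hpair : ∀ i j, i ≠ j → ρ i + ρ j ≤ L + 3 * E := fun i j hij =>
    S.log_card_add_log_card_le ha0 hE hL hij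
  have hsum : (K / 2 - ε) * L ≤ ∑ i, ρ i := by
    have h1 : ∑ i, n * R i * Real.log 2 ≤ ∑ i, ρ i :=
      Finset.sum_le_sum fun i _ => mul_log_two_le_log_card R i
    rw [← Finset.sum_mul, ← Finset.mul_sum] at h1
    refine le_trans ?_ h1
    have h2 : 0 < Real.log 2 := Real.log_pos one_lt_two
    have h3 := mul_le_mul_of_nonneg_right hcon.le (by positivity : 0 ≤ n * Real.log 2)
    have h4 : (K / 2 - ε) * (1 / 2 * Real.logb 2 p) * (n * Real.log 2) = (K / 2 - ε) * L := by
      rw [hLdef, Real.logb]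
      field_simp
    linarith
  set B : ℝ := L + 3 * E with hB
  set d : ℝ := (K - 1) * (3 * K) * E + (K - 1) * (2 * ε) * L with hd
  have hdef : ∀ i j, i ≠ j → B - ρ i - ρ j ≤ d := fun i j hij => by
    refine (pair_deficit_le ρ B hpair hij).trans ?_
    have h1 : K * B - 2 * ∑ m, ρ m ≤ 3 * K * E + 2 * ε * L := by
      rw [hB]
      linarith
    have h2 := mul_le_mul_of_nonneg_left h1 (by linarith : (0 : ℝ) ≤ K - 1)
    rw [hd]
    linarith
  have h1 := S.log_card_le_deficit ha0 hE hL hik hil hkl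
  have d1 := hdef i k hik
  have d2 := hdef i l hil
  have d3 := hdef k l hkl
  have d4 := hpair k l hkl
  have hρi : ρ i ≤ E + 3 * N * (2 * d) := by
    refine h1.trans ?_
    have h2 : 3 * N * (2 * B - 2 * ρ l - ρ i - ρ k) ≤ 3 * N * (2 * d) :=
      mul_le_mul_of_nonneg_left (by linarith) (by positivity)
    simp only [hρ] at h2 ⊢
    linarith
  have hE0 : 0 ≤ E := by positivity
  have h2 : L ≤ 2 * E + (2 + 12 * N) * d := by
    have h3 : B ≤ 2 * ρ i + 2 * d := by linarith
    linarith
  have h3 : (2 + 12 * N) * d =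
      (2 + 12 * N) * ((K - 1) * (3 * K)) * E + (2 + 12 * N) * ((K - 1) * (2 * ε)) * L := by
    rw [hd]
    ring
  rw [h3, hεeq] at h2
  have h4 : L ≤ n * c := by
    rw [hc, show n * (2 * ((2 + (2 + 12 * N) * ((K - 1) * (3 * K))) * κ)) =
      2 * ((2 + (2 + 12 * N) * ((K - 1) * (3 * K))) * E) by rw [hEdef]; ring]
    linarith
  have h5 := le_of_mul_le_mul_left h4 hn0
  linarith

end GIFC

theorem theorem2 (K : ℕ) (hK : 2 < K) (H : Matrix (Fin K) (Fin K) ℝ)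
    (hfull : GIFC.FullyConnected H) (hrat : ∀ i j, ∃ q : ℚ, H i j = (q : ℝ)) :
    GIFC.DoF H < (((K : ℝ) / 2 : ℝ) : EReal) := by
  obtain ⟨ε, hε, hev⟩ := GIFC.exists_sum_rate_lt hK H hfull hrat
  refine lt_of_le_of_lt (b := (((K : ℝ) / 2 - ε : ℝ) : EReal)) ?_
    (EReal.coe_lt_coe_iff.2 (by linarith))
  refine limsup_le_of_le (by isBoundedDefault) ?_
  filter_upwards [hev, eventually_gt_atTop 1] with p hp hp1
  have hpos : 0 < 1 / 2 * Real.logb 2 p := by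
    have := Real.logb_pos one_lt_two hp1
    positivity
  rw [EReal.div_le_iff_le_mul (EReal.coe_pos.2 hpos) (EReal.coe_ne_top _)]
  refine iSup₂_le fun R hR => ?_
  rw [← EReal.coe_mul, EReal.coe_le_coe_iff]
  linarith [hp R hR]
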